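/- All diagrams are drawn in the plane, up to planar isotopy; a 4-valent graph may have closed curves without vertices as components. A regular isotopy of link diagrams is a finite sequence of planar isotopies and of Reidemeister moves of types II and III. Let $R$ be a commutative ring and let $A\in R$ be a unit such that $A-A^{-1}$ is not a zero divisor (for example $R=\mathbb Z[A,A^{-1}]$). Fix one of the two kinds of crossing in a picture with four marked ends, say $\chi_1$, and let $\chi_2$ be its rotation by $90^\circ$ (the opposite crossing). Let $S_A$ be the smoothing that joins the two regions swept out by the overpassing strand of $\chi_1$ when it is rotated counterclockwise, and let $S_B$ be the other smoothing. Write $\times$ for a rigid 4-valent vertex. For a unit $a\in R$ and $z\in R$, a *Dubrovnik polynomial* with parameters $a,z$ is a function $D$ from unoriented link diagrams to $R$ that is invariant under regular isotopy and satisfies $$D(\chi_2)-D(\chi_1)=z\,\bigl(D(S_B)-D(S_A)\bigr)$$ for diagrams that differ only in the marked picture; $D(L')=a\,D(L)$, respectively $D(L')=a^{-1}D(L)$, if $L'$ is obtained from $L$ by inserting in a strand a curl whose crossing, seen as $\chi_1$, has $S_A$, respectively $S_B$, as the smoothing that splits off a circle; and $D(\text{unknot})=1$. For a planar 4-valent graph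 $G$ (a diagram with vertices and without crossings), and $A,B\in R$, choose at each vertex a marker, that is, one of the two ways $\chi_1,\chi_2$ to replace the vertex by a crossing. The *Kauffman–Vogel polynomial* is the state sum $[G]$ obtained from a Dubrovnik polynomial $D$ with $z=A-B$ by expanding multilinearly over all vertices according to $$[\times]=D(\chi_1)-A\,D(S_A)-B\,D(S_B)\quad\text{or}\quad[\times]=D(\chi_2)-A\,D(S_B)-B\,D(S_A),$$ depending on the marker; equivalently $[G]=\sum_L(-A)^{i(L)}(-B)^{j(L)}D(L)$, the sum being over all link diagrams $L$ obtained by replacing every vertex of $G$ by the crossing chosen at it or by one of its two smoothings, where $i(L)$ and $j(L)$ are the numbers of smoothings with coefficient $-A$ and $-B$. **Theorem 4.** Let $a=A$ and $B=A^{-1}$, so that $z=A-A^{-1}$. A Dubrovnik polynomial $D$ with these parameters exists, and for every such $D$, every nonempty planar 4-valent graph $G$ and every choice of markers, $$[G]=2^{c-1}\,(-A-A^{-1})^{v},$$ where $c$ is the number of connected components of $G$ (closed curves included) and $v$ is the number of its vertices. -/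

import Mathlib

/-!
Four-valent rigid vertex graph diagrams in the plane, unoriented link diagrams, regular isotopy,
the Dubrovnik polynomial and the Kauffman-Vogel state sum.

A diagram in the plane is put in Morse position with respect to the height function, and is
recorded as the list, from bottom to top, of its elementary layers. A layer with `p` strands to
the left of its singular piece is one of: a local minimum, a local maximum, a crossing of either
kind, a 4-valent vertex; all its other strands are vertical. Every diagram in the plane (with
closed curves without vertices allowed as components) is of this form up to planar isotopy.
-/

namespace KauffmanVogel

/-- The elementary pieces.
`cup`: local minimum (two strands are born). `cap`: local maximum (two strands die).
`crossNW`: crossing whose overpassing strand runs from bottom right to top left.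
`crossNE`: crossing whose overpassing strand runs from bottom left to top right, i.e. `crossNW` rotated
by a quarter turn. `vertex`: a rigid 4-valent vertex, two ends going down and two ends going up. -/
inductive Kind
  | cup
  | cap
  | crossNW
  | crossNE
  | vertex
  deriving DecidableEq

/-- Number of strands entering a piece from below. -/
def Kind.ins : Kind → ℕ
  | .cup => 0
  | .cap => 2
  | .crossNW => 2
  | .crossNE => 2
  | .vertex => 2

/-- Number of strands leaving a piece at the top. -/
def Kind.outs : Kind → ℕ
  | .cup => 2
  | .cap => 0
  | .crossNW => 2
  | .crossNE => 2
  | .vertex => 2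

/-- A layer: the piece `kind` with `pos` vertical strands to its left. -/
structure Layer where
  kind : Kind
  pos : ℕ
  deriving DecidableEq

/-- Local minimum creating the strands number `i` and `i + 1` (strands are numbered from `0`). -/
abbrev cup (i : ℕ) : Layer := ⟨.cup, i⟩
/-- Local maximum joining the strands number `i` and `i + 1`. -/
abbrev cap (i : ℕ) : Layer := ⟨.cap, i⟩
/-- Crossing of the strands number `i` and `i + 1`, of kind `crossNW`. -/
abbrev crossNW (i : ℕ) : Layer := ⟨.crossNW, i⟩
/-- Crossing of the strands number `i` and `i + 1`, of kind `crossNE`. -/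
abbrev crossNE (i : ℕ) : Layer := ⟨.crossNE, i⟩
/-- Four-valent vertex at the strands number `i` and `i + 1`. -/
abbrev vertex (i : ℕ) : Layer := ⟨.vertex, i⟩

/-- `IsTangle n w m`: the layers `w`, from bottom to top, fit together to a picture with `n` ends
at the bottom and `m` ends at the top. -/
def IsTangle : ℕ → List Layer → ℕ → Prop
  | n, [], m => n = m
  | n, x :: w, m => x.pos + x.kind.ins ≤ n ∧ IsTangle (n - x.kind.ins + x.kind.outs) w m

/-- A (closed) 4-valent graph diagram in the plane: no ends at the bottom or at the top. -/
def IsDiagram (w : List Layer) : Prop := IsTangle 0 w 0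

/-- A link diagram: a diagram without vertices. -/
def IsLink (w : List Layer) : Prop := IsDiagram w ∧ ∀ x ∈ w, x.kind ≠ .vertex

/-- A planar 4-valent graph (drawn in the plane): a diagram without crossings. -/
def IsPlanarGraph (w : List Layer) : Prop :=
  IsDiagram w ∧ ∀ x ∈ w, x.kind ≠ .crossNW ∧ x.kind ≠ .crossNE

/-! ### Vertices and connected components -/

/-- Number of vertices. -/
def numVertices (w : List Layer) : ℕ := w.countP fun x => decide (x.kind = .vertex)

/-- Number of strands above the layers `w` of a diagram. -/
def width (w : List Layer) : ℕ := w.foldl (fun n x => n - x.kind.ins + x.kind.outs) 0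

/-- The points of the diagram that lie at the levels between layers: `(k, j)` is the point of
strand number `j` just above the first `k` layers. Every edge, and every closed curve without
vertices, passes through at least one of them. -/
def Point (w : List Layer) : Type :=
  {p : ℕ × ℕ // p.1 ≤ w.length ∧ p.2 < width (w.take p.1)}

/-- Two points are joined inside layer number `k`, in the embedded graph given by the diagram: at
a crossing the strands pass through each other, at a vertex all four ends meet. -/
inductive Joined (w : List Layer) : ℕ × ℕ → ℕ × ℕ → Prop
  | left (k j : ℕ) (x : Layer) (hx : w[k]? = some x) (hj : j < x.pos) :
      Joined w (k, j) (k + 1, j)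
  | right (k j : ℕ) (x : Layer) (hx : w[k]? = some x) (hj : x.pos ≤ j) :
      Joined w (k, j + x.kind.ins) (k + 1, j + x.kind.outs)
  | cup (k i : ℕ) (hx : w[k]? = some (cup i)) : Joined w (k + 1, i) (k + 1, i + 1)
  | cap (k i : ℕ) (hx : w[k]? = some (cap i)) : Joined w (k, i) (k, i + 1)
  | crossUp (k i : ℕ) (hx : w[k]? = some (crossNW i) ∨ w[k]? = some (crossNE i)) :
      Joined w (k, i) (k + 1, i + 1)
  | crossDown (k i : ℕ) (hx : w[k]? = some (crossNW i) ∨ w[k]? = some (crossNE i)) :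
      Joined w (k, i + 1) (k + 1, i)
  | vertex (k i s t : ℕ) (hx : w[k]? = some (vertex i)) (hs : s ≤ 1) (ht : t ≤ 1) :
      Joined w (k, i + s) (k + 1, i + t)

/-- Number of connected components of the graph (closed curves included). -/
noncomputable def numComponents (w : List Layer) : ℕ :=
  Nat.card (Quot fun p q : Point w => Joined w p.1 q.1)

/-! ### Regular isotopy of link diagrams -/

/-- The elementary local moves, as replacements of consecutive layers. -/
inductive RegularMove : List Layer → List Layer → Prop
  /-- Planar isotopy: the heights of two pieces, one to the left of the other, are exchanged. -/
  | exchange (p q : Kind) (i j : ℕ) (hij : i ≤ j) :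
      RegularMove [⟨p, i⟩, ⟨q, j + p.outs⟩] [⟨q, j + p.ins⟩, ⟨p, i⟩]
  /-- Planar isotopy: a strand is straightened. -/
  | zigzagLeft (i : ℕ) : RegularMove [cup i, cap (i + 1)] []
  | zigzagRight (i : ℕ) : RegularMove [cup (i + 1), cap i] []
  /-- Planar isotopy: a crossing is rotated past a maximum or a minimum of one of its strands. -/
  | overCap (i : ℕ) : RegularMove [crossNW (i + 1), cap i] [crossNE i, cap (i + 1)]
  | underCap (i : ℕ) : RegularMove [crossNE (i + 1), cap i] [crossNW i, cap (i + 1)]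
  | overCup (i : ℕ) : RegularMove [cup i, crossNW (i + 1)] [cup (i + 1), crossNE i]
  | underCup (i : ℕ) : RegularMove [cup i, crossNE (i + 1)] [cup (i + 1), crossNW i]
  /-- The second Reidemeister move. -/
  | reidemeisterTwo (i : ℕ) : RegularMove [crossNW i, crossNE i] []
  | reidemeisterTwo' (i : ℕ) : RegularMove [crossNE i, crossNW i] []
  /-- The third Reidemeister move. -/
  | reidemeisterThree (i : ℕ) :
      RegularMove [crossNW i, crossNW (i + 1), crossNW i] [crossNW (i + 1), crossNW i, crossNW (i + 1)]

/-- `D` is the Dubrovnik polynomial with parameters `a` and `z`: an invariant of link diagrams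
under regular isotopy that satisfies the skein relation, the two curl relations and is `1` on the
unknot. (Only the values of `D` on link diagrams matter.) -/
structure IsDubrovnik {R : Type*} [CommRing R] (a : Rˣ) (z : R) (D : List Layer → R) : Prop where
  regularIsotopy : ∀ l r u v : List Layer, RegularMove l r →
    IsLink (u ++ l ++ v) → IsLink (u ++ r ++ v) → D (u ++ l ++ v) = D (u ++ r ++ v)
  skein : ∀ (u v : List Layer) (i : ℕ), IsLink (u ++ [crossNE i] ++ v) →
    D (u ++ [crossNE i] ++ v) - D (u ++ [crossNW i] ++ v) =
      z * (D (u ++ v) - D (u ++ [cap i, cup i] ++ v))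
  curl : ∀ (u v : List Layer) (i : ℕ), IsLink (u ++ [cup (i + 1), crossNE i, cap (i + 1)] ++ v) →
    D (u ++ [cup (i + 1), crossNE i, cap (i + 1)] ++ v) = (a : R) * D (u ++ v)
  curlInv : ∀ (u v : List Layer) (i : ℕ), IsLink (u ++ [cup (i + 1), crossNW i, cap (i + 1)] ++ v) →
    D (u ++ [cup (i + 1), crossNW i, cap (i + 1)] ++ v) = ((a⁻¹ : Rˣ) : R) * D (u ++ v)
  unknot : D [cup 0, cap 0] = 1

/-! ### The Kauffman-Vogel polynomial -/

/-- The replacements of a layer, with their coefficients. A vertex is replaced, according to its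
marker, by one of the two crossings or by one of the two smoothings (two vertical strands, `[]`,
or a maximum below a minimum, `[cap i, cup i]`); any other layer is kept. -/
def resolve {R : Type*} [CommRing R] (A B : R) (marker : Bool) : Layer → List (R × List Layer)
  | ⟨.vertex, i⟩ =>
      if marker then [(1, [crossNW i]), (-A, [cap i, cup i]), (-B, [])]
      else [(1, [crossNE i]), (-A, []), (-B, [cap i, cup i])]
  | x => [(1, [x])]

/-- All link diagrams obtained from a diagram by replacing all vertices, each with the product of
its coefficients. The marker at a vertex in layer number `k` is `m k`. -/
def states {R : Type*} [CommRing R] (A B : R) :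
    (ℕ → Bool) → List Layer → List (R × List Layer)
  | _, [] => [(1, [])]
  | m, x :: w =>
      (resolve A B (m 0) x).flatMap fun s =>
        (states A B (fun k => m (k + 1)) w).map fun t => (s.1 * t.1, s.2 ++ t.2)

/-- The Kauffman-Vogel state sum of the diagram `w`, with markers `m`, in terms of the Dubrovnik
polynomial `D`. -/
def kauffmanVogel {R : Type*} [CommRing R] (D : List Layer → R) (A B : R) (m : ℕ → Bool)
    (w : List Layer) : R :=
  ((states A B m w).map fun s => s.1 * D s.2).sum

end KauffmanVogel

namespace KauffmanVogel

/-! For these parameters the Dubrovnik polynomial is an orientation sum. Add up $A^{\text{writhe}}$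
over all orientations of a link diagram. Regular isotopy preserves the sum, a curl multiplies it by
$A^{\pm1}$, and the skein relation can be checked on the orientations of four ends. The unknot gets
$2$. Reversing all strands preserves the writhe, so fixing the direction at the lowest minimum takes
half the sum without dividing by $2$ in $R$ (`isDubrovnik_halfOrientationSum`).

Any other Dubrovnik polynomial agrees with it on nonempty links. Let $E$ be the difference of two of
them, and argue by induction on the number of crossings (`IsDubrovnikDifference.eq_zero`). If $E$
vanishes on diagrams with fewer crossings, the skein relation lets crossings be switched, so $E$
depends only on the 4-valent shadow. It is then invariant under the shadows of regular isotopies.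
Every nonempty shadow can be moved, without creating pieces, to one containing a bigon, a curl or a
circle (`null_of_isPlanarGraph`). Bigons and curls reduce the crossing number, and a circle can be
removed because $z$ is not a zero divisor.

So $[G]$ may be computed with the orientation sum. Expanding a vertex gives zero unless its four
ends alternate between in and out, and then the factor is $-A-B$ (`sum_resolve`). An alternating
orientation, compared with the checkerboard one, is a two-colouring constant on components. There
are $2^c$ of these (`orientationSum_eq_ncard`, `ncard_colourings`), and half of them are counted. -/

lemma isTangle_append {n m : ℕ} {u v : List Layer} :
    IsTangle n (u ++ v) m ↔ ∃ k, IsTangle n u k ∧ IsTangle k v m := by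
  induction u generalizing n with
  | nil => simp [IsTangle]
  | cons x u ih => simp [IsTangle, ih, and_assoc]

lemma isTangle_replace {n m : ℕ} {l r u v : List Layer}
    (h : ∀ a b, IsTangle a l b → IsTangle a r b) (hw : IsTangle n (u ++ l ++ v) m) :
    IsTangle n (u ++ r ++ v) m := by
  simp only [List.append_assoc, isTangle_append] at hw ⊢
  obtain ⟨a, h1, b, h2, h3⟩ := hw
  exact ⟨a, h1, b, h _ _ h2, h3⟩

/-! ### Transfer operators for orientation sums -/

section Transfer

variable {R : Type*} [CommRing R] (p q c : R)

/-- The transfer operator of a piece in leftmost position. A state lists the orientations of the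
strands (`true` is upwards), and `p`, `q` are the weights of positive and negative crossings,
`c` that of a vertex with alternating orientations of its ends. -/
def kindTransfer : Kind → (List Bool → R) → List Bool → R
  | .cup, g, b => g (true :: false :: b) + g (false :: true :: b)
  | .cap, g, x :: y :: b => if x = y then 0 else g b
  | .crossNW, g, x :: y :: b => (if x = y then q else p) * g (y :: x :: b)
  | .crossNE, g, x :: y :: b => (if x = y then p else q) * g (y :: x :: b)
  | .vertex, g, x :: y :: b => if x = y then 0 else c * g (x :: y :: b)
  -- Reached only when fewer than two strands are available, which `IsTangle` rules out.
  | _, _, _ => 0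

/-- The transfer operator of a layer. -/
def layerTransfer (x : Layer) (f : List Bool → R) (s : List Bool) : R :=
  kindTransfer p q c x.kind (fun b => f (s.take x.pos ++ b)) (s.drop x.pos)

/-- The transfer operator of a list of layers. -/
def transfer : List Layer → (List Bool → R) → List Bool → R
  | [], f => f
  | x :: w, f => layerTransfer p q c x (transfer w f)

/-- The weighted number of orientations of a tangle without upper ends that extend a given
orientation of its lower ends. -/
def orientationSum (w : List Layer) (s : List Bool) : R :=
  transfer p q c w (fun t => if t = [] then 1 else 0) s

lemma transfer_append (u v : List Layer) (f : List Bool → R) :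
    transfer p q c (u ++ v) f = transfer p q c u (transfer p q c v f) := by
  induction u with
  | nil => rfl
  | cons x u ih => simp [transfer, ih]

lemma kindTransfer_add (k : Kind) (f g : List Bool → R) (s : List Bool) :
    kindTransfer p q c k (fun b => f b + g b) s =
      kindTransfer p q c k f s + kindTransfer p q c k g s := by
  cases k <;> rcases s with _ | ⟨x, _ | ⟨y, s⟩⟩ <;> simp [kindTransfer] <;> (try split_ifs) <;>
    (try simp) <;> (try ring)

lemma kindTransfer_mul (k : Kind) (a : R) (f : List Bool → R) (s : List Bool) :
    kindTransfer p q c k (fun b => a * f b) s = a * kindTransfer p q c k f s := by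
  cases k <;> rcases s with _ | ⟨x, _ | ⟨y, s⟩⟩ <;> simp [kindTransfer] <;> (try split_ifs) <;>
    (try simp) <;> (try ring)

/-- The weights depend only on whether two orientations agree, so reversing every strand preserves
them. -/
lemma kindTransfer_not (k : Kind) (f : List Bool → R) (s : List Bool) :
    kindTransfer p q c k f (s.map not) = kindTransfer p q c k (fun b => f (b.map not)) s := by
  cases k <;> rcases s with _ | ⟨x, _ | ⟨y, s⟩⟩ <;> simp [kindTransfer, add_comm]

lemma layerTransfer_add (x : Layer) (f g : List Bool → R) (s : List Bool) :
    layerTransfer p q c x (fun b => f b + g b) s =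
      layerTransfer p q c x f s + layerTransfer p q c x g s :=
  kindTransfer_add ..

lemma layerTransfer_mul (x : Layer) (a : R) (f : List Bool → R) (s : List Bool) :
    layerTransfer p q c x (fun b => a * f b) s = a * layerTransfer p q c x f s :=
  kindTransfer_mul ..

lemma layerTransfer_zero (x : Layer) (s : List Bool) :
    layerTransfer p q c x (fun _ => 0) s = 0 := by
  simpa using layerTransfer_mul p q c x 0 (fun _ => 0) s

lemma layerTransfer_not (x : Layer) (f : List Bool → R) (s : List Bool) :
    layerTransfer p q c x f (s.map not) = layerTransfer p q c x (fun b => f (b.map not)) s := by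
  simp only [layerTransfer, ← List.map_drop, kindTransfer_not, ← List.map_take, List.map_append]

lemma transfer_not (w : List Layer) (f : List Bool → R) (s : List Bool) :
    transfer p q c w f (s.map not) = transfer p q c w (fun b => f (b.map not)) s := by
  induction w generalizing s with
  | nil => rfl
  | cons x w ih =>
    simp only [transfer, layerTransfer_not]
    congr 1
    funext b
    exact ih b

lemma transfer_add (w : List Layer) (f g : List Bool → R) (s : List Bool) :
    transfer p q c w (fun b => f b + g b) s = transfer p q c w f s + transfer p q c w g s := by
  induction w generalizing s with
  | nil => rfl
  | cons x w ih =>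
    simp only [transfer, ← layerTransfer_add]
    congr 1
    funext b
    exact ih b

lemma transfer_mul (w : List Layer) (a : R) (f : List Bool → R) (s : List Bool) :
    transfer p q c w (fun b => a * f b) s = a * transfer p q c w f s := by
  induction w generalizing s with
  | nil => rfl
  | cons x w ih =>
    simp only [transfer, ← layerTransfer_mul]
    congr 1
    funext b
    exact ih b

lemma transfer_sub (w : List Layer) (f g : List Bool → R) (s : List Bool) :
    transfer p q c w (fun b => f b - g b) s = transfer p q c w f s - transfer p q c w g s := by
  have h := transfer_add p q c w f (fun b => -1 * g b) s
  rw [transfer_mul] at h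
  simpa [← sub_eq_add_neg] using h

lemma orientationSum_not (w : List Layer) (s : List Bool) :
    orientationSum p q c w (s.map not) = orientationSum p q c w s := by
  simp [orientationSum, transfer_not]

lemma layerTransfer_append (k : Kind) (i : ℕ) (f : List Bool → R) (a b : List Bool) :
    layerTransfer p q c ⟨k, a.length + i⟩ f (a ++ b) =
      layerTransfer p q c ⟨k, i⟩ (fun t => f (a ++ t)) b := by
  simp [layerTransfer, List.take_length_add_append, List.drop_length_add_append]

lemma layerTransfer_cons (k : Kind) (i : ℕ) (f : List Bool → R) (x : Bool) (b : List Bool) :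
    layerTransfer p q c ⟨k, i + 1⟩ f (x :: b) =
      layerTransfer p q c ⟨k, i⟩ (fun t => f (x :: t)) b := by
  simp [layerTransfer]

lemma layerTransfer_cons_cons (k : Kind) (i : ℕ) (f : List Bool → R) (x y : Bool) (b : List Bool) :
    layerTransfer p q c ⟨k, i + 2⟩ f (x :: y :: b) =
      layerTransfer p q c ⟨k, i⟩ (fun t => f (x :: y :: t)) b := by
  simp [layerTransfer]

lemma layerTransfer_at_zero (k : Kind) (f : List Bool → R) (b : List Bool) :
    layerTransfer p q c ⟨k, 0⟩ f b = kindTransfer p q c k f b := by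
  simp [layerTransfer]

/-- The strands `a` are spectators, so local identities need checking only in leftmost position. -/
lemma transfer_shift (w : List Layer) (f : List Bool → R) (a b : List Bool) :
    transfer p q c (w.map fun x => ⟨x.kind, a.length + x.pos⟩) f (a ++ b) =
      transfer p q c w (fun t => f (a ++ t)) b := by
  induction w generalizing b with
  | nil => rfl
  | cons x w ih =>
    simp only [List.map_cons, transfer, layerTransfer_append]
    congr 1
    funext t
    exact ih t

lemma kindTransfer_congr (k : Kind) (f g : List Bool → R) (s : List Bool)
    (h : ∀ t, t.length = s.length - k.ins + k.outs → f t = g t) :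
    kindTransfer p q c k f s = kindTransfer p q c k g s := by
  cases k <;> rcases s with _ | ⟨x, _ | ⟨y, s⟩⟩ <;>
    simp_all [kindTransfer, Kind.ins, Kind.outs]

lemma layerTransfer_congr (x : Layer) (f g : List Bool → R) (s : List Bool)
    (hs : x.pos + x.kind.ins ≤ s.length)
    (h : ∀ t, t.length = s.length - x.kind.ins + x.kind.outs → f t = g t) :
    layerTransfer p q c x f s = layerTransfer p q c x g s := by
  refine kindTransfer_congr _ _ _ _ _ _ _ fun t ht => h _ ?_
  simp only [List.length_append, List.length_take, List.length_drop] at ht ⊢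
  omega

lemma transfer_congr {w : List Layer} {k : ℕ} (f g : List Bool → R) (s : List Bool)
    (hw : IsTangle s.length w k) (h : ∀ t, t.length = k → f t = g t) :
    transfer p q c w f s = transfer p q c w g s := by
  induction w generalizing s with
  | nil => exact h _ hw
  | cons x w ih =>
    refine layerTransfer_congr _ _ _ _ _ _ _ hw.1 fun t ht => ih t ?_
    rw [ht]
    exact hw.2

/-- To compare two lists of layers with the same strands to their left, these may be left out. -/
lemma transfer_eq_of_shift {l r : List Layer} (i n : ℕ)
    (h : ∀ (f : List Bool → R) (b : List Bool), n ≤ b.length →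
      transfer p q c l f b = transfer p q c r f b)
    (f : List Bool → R) (s : List Bool) (hs : i + n ≤ s.length) :
    transfer p q c (l.map fun x => ⟨x.kind, i + x.pos⟩) f s =
      transfer p q c (r.map fun x => ⟨x.kind, i + x.pos⟩) f s := by
  have hi : (s.take i).length = i := by simp; omega
  have h1 := transfer_shift p q c l f (s.take i) (s.drop i)
  have h2 := transfer_shift p q c r f (s.take i) (s.drop i)
  rw [hi, List.take_append_drop] at h1 h2
  rw [h1, h2]
  exact h _ _ (by simp; omega)

/-- The left piece acts linearly, with coefficients read off its own strands only; hence it commutes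
with a piece acting further right. -/
lemma transfer_exchange (k k' : Kind) (i j : ℕ) (hij : i ≤ j) (f : List Bool → R) (s : List Bool)
    (hs : i + k.ins ≤ s.length) :
    transfer p q c [⟨k, i⟩, ⟨k', j + k.outs⟩] f s =
      transfer p q c [⟨k', j + k.ins⟩, ⟨k, i⟩] f s := by
  obtain ⟨d, rfl⟩ := Nat.exists_eq_add_of_le hij
  have key := transfer_eq_of_shift p q c (l := [⟨k, 0⟩, ⟨k', d + k.outs⟩])
    (r := [⟨k', d + k.ins⟩, ⟨k, 0⟩]) i k.ins ?_ f s hs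
  · simpa [add_assoc] using key
  intro f b hb
  simp only [transfer]
  rw [layerTransfer_at_zero]
  have hz : ∀ g : List Bool → R, layerTransfer p q c ⟨k, 0⟩ g = kindTransfer p q c k g :=
    fun g => funext (layerTransfer_at_zero p q c k g)
  rw [hz]
  cases k
  case cup =>
    simp only [kindTransfer, Kind.ins, Kind.outs, layerTransfer_cons_cons, Nat.add_zero]
    exact (layerTransfer_add ..).symm
  all_goals
    obtain ⟨x, y, b, rfl⟩ : ∃ x y t, b = x :: y :: t := by
      rcases b with _ | ⟨x, _ | ⟨y, b⟩⟩ <;> simp [Kind.ins] at hb ⊢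
    simp only [kindTransfer, Kind.ins, Kind.outs, layerTransfer_cons_cons, layerTransfer_mul,
      Nat.add_zero]
  all_goals
    split_ifs <;> simp only [layerTransfer_zero, layerTransfer_mul]

/-- The elementary moves do not change the transfer operator. -/
lemma transfer_regularMove (hpq : p * q = 1) {l r : List Layer} (h : RegularMove l r) {n m m' : ℕ}
    (hl : IsTangle n l m) (hr : IsTangle n r m') (f : List Bool → R) (s : List Bool)
    (hs : s.length = n) : transfer p q c l f s = transfer p q c r f s := by
  have hqp : q * p = 1 := by rw [mul_comm, hpq]
  have key : ∀ (l r : List Layer) (i n : ℕ), i + n ≤ s.length →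
      (∀ (f : List Bool → R) (b : List Bool), n ≤ b.length →
        transfer p q c l f b = transfer p q c r f b) →
      transfer p q c (l.map fun x => ⟨x.kind, i + x.pos⟩) f s =
        transfer p q c (r.map fun x => ⟨x.kind, i + x.pos⟩) f s :=
    fun l r i n hn h => transfer_eq_of_shift p q c i n h f s hn
  have two : ∀ b : List Bool, 2 ≤ b.length → ∃ x y t, b = x :: y :: t := by
    rintro (_ | ⟨x, _ | ⟨y, b⟩⟩) hb <;> simp at hb ⊢
  have three : ∀ b : List Bool, 3 ≤ b.length → ∃ x y z t, b = x :: y :: z :: t := by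
    rintro (_ | ⟨x, _ | ⟨y, _ | ⟨z, b⟩⟩⟩) hb <;> simp at hb ⊢
  have c1 : ∀ k (g : List Bool → R) x b, layerTransfer p q c ⟨k, 1⟩ g (x :: b) =
      kindTransfer p q c k (fun t => g (x :: t)) b := fun k g x b => by
    rw [← layerTransfer_at_zero, ← layerTransfer_cons]
  have hl' := hl
  cases h <;> simp [IsTangle, Kind.ins, Kind.outs] at hl hr
  case exchange k k' i j hij => exact transfer_exchange p q c k k' i j hij f s (hs ▸ hl'.1)
  case zigzagLeft i =>
    refine key [cup 0, cap 1] [] i 1 (by omega) fun f b hb => ?_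
    obtain ⟨x, b, rfl⟩ := List.exists_cons_of_length_pos hb
    cases x <;> simp [transfer, layerTransfer_at_zero, c1, kindTransfer]
  case zigzagRight i =>
    refine key [cup 1, cap 0] [] i 1 (by omega) fun f b hb => ?_
    obtain ⟨x, b, rfl⟩ := List.exists_cons_of_length_pos hb
    cases x <;> simp [transfer, layerTransfer_at_zero, c1, kindTransfer]
  case overCap i =>
    refine key [crossNW 1, cap 0] [crossNE 0, cap 1] i 3 (by omega) fun f b hb => ?_
    obtain ⟨x, y, z, b, rfl⟩ := three b hb
    cases x <;> cases y <;> cases z <;> simp [transfer, layerTransfer_at_zero, c1, kindTransfer]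
  case underCap i =>
    refine key [crossNE 1, cap 0] [crossNW 0, cap 1] i 3 (by omega) fun f b hb => ?_
    obtain ⟨x, y, z, b, rfl⟩ := three b hb
    cases x <;> cases y <;> cases z <;> simp [transfer, layerTransfer_at_zero, c1, kindTransfer]
  case overCup i =>
    refine key [cup 0, crossNW 1] [cup 1, crossNE 0] i 1 (by omega) fun f b hb => ?_
    obtain ⟨x, b, rfl⟩ := List.exists_cons_of_length_pos hb
    cases x <;> simp [transfer, layerTransfer_at_zero, c1, kindTransfer, add_comm]
  case underCup i =>
    refine key [cup 0, crossNE 1] [cup 1, crossNW 0] i 1 (by omega) fun f b hb => ?_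
    obtain ⟨x, b, rfl⟩ := List.exists_cons_of_length_pos hb
    cases x <;> simp [transfer, layerTransfer_at_zero, c1, kindTransfer, add_comm]
  case reidemeisterTwo i =>
    refine key [crossNW 0, crossNE 0] [] i 2 (by omega) fun f b hb => ?_
    obtain ⟨x, y, b, rfl⟩ := two b hb
    cases x <;> cases y <;>
      simp [transfer, layerTransfer_at_zero, kindTransfer, ← mul_assoc, hpq, hqp]
  case reidemeisterTwo' i =>
    refine key [crossNE 0, crossNW 0] [] i 2 (by omega) fun f b hb => ?_
    obtain ⟨x, y, b, rfl⟩ := two b hb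
    cases x <;> cases y <;>
      simp [transfer, layerTransfer_at_zero, kindTransfer, ← mul_assoc, hpq, hqp]
  case reidemeisterThree i =>
    refine key [crossNW 0, crossNW 1, crossNW 0] [crossNW 1, crossNW 0, crossNW 1] i 3 (by omega)
      fun f b hb => ?_
    obtain ⟨x, y, z, b, rfl⟩ := three b hb
    cases x <;> cases y <;> cases z <;>
      simp [transfer, layerTransfer_at_zero, c1, kindTransfer] <;> ring

/-- For parallel strands the horizontal smoothing admits no orientation and the crossings differ by
`p - q`. For antiparallel strands the signs are exchanged; of the two orientations of the new
minimum, one cancels the vertical smoothing and the other is the state above the crossing. -/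
lemma transfer_skein (i : ℕ) (f : List Bool → R) (s : List Bool) (hs : i + 2 ≤ s.length) :
    transfer p q c [crossNE i] f s - transfer p q c [crossNW i] f s =
      (p - q) * (f s - transfer p q c [cap i, cup i] f s) := by
  have hi : (s.take i).length = i := by simp; omega
  have h := fun l => transfer_shift p q c l f (s.take i) (s.drop i)
  have h1 := h [crossNE 0]
  have h2 := h [crossNW 0]
  have h3 := h [cap 0, cup 0]
  have h4 : f s = f (s.take i ++ s.drop i) := by rw [List.take_append_drop]
  rw [hi, List.take_append_drop] at h1 h2 h3
  simp only [List.map_cons, List.map_nil, Nat.add_zero] at h1 h2 h3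
  rw [h1, h2, h3, h4]
  obtain ⟨x, y, b, hb⟩ : ∃ x y t, s.drop i = x :: y :: t := by
    have : 2 ≤ (s.drop i).length := by simp; omega
    revert this
    rcases s.drop i with _ | ⟨x, _ | ⟨y, b⟩⟩ <;> simp
  rw [hb]
  cases x <;> cases y <;> simp [transfer, layerTransfer_at_zero, kindTransfer] <;> ring

/-- The direction of the strand forces that of the loop, and both strands at the crossing then run
parallel, whichever direction was given. -/
lemma transfer_curl (i : ℕ) (f : List Bool → R) (s : List Bool) (hs : i + 1 ≤ s.length) :
    transfer p q c [cup (i + 1), crossNE i, cap (i + 1)] f s = p * f s ∧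
      transfer p q c [cup (i + 1), crossNW i, cap (i + 1)] f s = q * f s := by
  have hi : (s.take i).length = i := by simp; omega
  have h := fun l => transfer_shift p q c l f (s.take i) (s.drop i)
  have h1 := h [cup 1, crossNE 0, cap 1]
  have h2 := h [cup 1, crossNW 0, cap 1]
  have h4 : f s = f (s.take i ++ s.drop i) := by rw [List.take_append_drop]
  rw [hi, List.take_append_drop] at h1 h2
  simp only [List.map_cons, List.map_nil, Nat.add_zero] at h1 h2
  rw [h1, h2, h4]
  obtain ⟨x, b, hb⟩ : ∃ x t, s.drop i = x :: t :=
    List.exists_cons_of_length_pos (by simp; omega)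
  rw [hb]
  have c1 : ∀ k (g : List Bool → R) x b, layerTransfer p q c ⟨k, 1⟩ g (x :: b) =
      kindTransfer p q c k (fun t => g (x :: t)) b := fun k g x b => by
    rw [← layerTransfer_at_zero, ← layerTransfer_cons]
  cases x <;> simp [transfer, layerTransfer_at_zero, c1, kindTransfer]

/-- The sum over the orientations of a diagram that begins with a local minimum, in which the left
strand at this minimum is directed upwards. -/
def halfOrientationSum (w : List Layer) : R := orientationSum p q c w.tail [true, false]

end Transfer

/-! ### Existence of the Dubrovnik polynomial -/

lemma exists_eq_cup_cons {w : List Layer} (hw : IsDiagram w) (h : w ≠ []) :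
    ∃ w', w = cup 0 :: w' ∧ IsTangle 2 w' 0 := by
  rcases w with _ | ⟨⟨k, i⟩, w⟩
  · exact absurd rfl h
  · cases k <;> simp [IsDiagram, IsTangle, Kind.ins, Kind.outs] at hw ⊢
    exact hw

lemma isTangle_unique {n m m' : ℕ} {w : List Layer} (h : IsTangle n w m) (h' : IsTangle n w m') :
    m = m' := by
  induction w generalizing n with
  | nil => exact h.symm.trans h'
  | cons x w ih => exact ih h.2 h'.2

lemma exists_split {u l v : List Layer} (h : IsDiagram (u ++ l ++ v)) (hu : u ≠ []) :
    ∃ u' k m, u = cup 0 :: u' ∧ IsTangle 2 u' k ∧ IsTangle k l m ∧ IsTangle m v 0 := by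
  rcases u with _ | ⟨x, u⟩
  · exact absurd rfl hu
  obtain ⟨w, hw, h'⟩ := exists_eq_cup_cons h (by simp)
  obtain ⟨rfl, rfl⟩ : x = cup 0 ∧ u ++ l ++ v = w := List.cons_eq_cons.1 hw
  simp only [isTangle_append] at h'
  obtain ⟨m, ⟨k, h1, h2⟩, h3⟩ := h'
  exact ⟨u, k, m, rfl, h1, h2, h3⟩

lemma orientationSum_congr_middle {R : Type*} [CommRing R] (p q c : R) {u l r : List Layer} {k : ℕ}
    (v : List Layer) (s : List Bool) (hu : IsTangle s.length u k)
    (h : ∀ f : List Bool → R, ∀ t : List Bool, t.length = k →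
      transfer p q c l f t = transfer p q c r f t) :
    orientationSum p q c (u ++ l ++ v) s = orientationSum p q c (u ++ r ++ v) s := by
  simp only [orientationSum, transfer_append]
  exact transfer_congr _ _ _ _ _ _ hu fun t ht => h _ t ht

/-- Each relation is local, so it passes through `transfer` unless it touches the first layer, where
an orientation has been fixed. Only one isotopy can do that. -/
theorem isDubrovnik_halfOrientationSum {R : Type*} [CommRing R] (A : Rˣ) (c : R) :
    IsDubrovnik A ((A : R) - ((A⁻¹ : Rˣ) : R))
      (halfOrientationSum (A : R) ((A⁻¹ : Rˣ) : R) c) where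
  regularIsotopy l r u v h hl hr := by
    by_cases hu : u = []
    · subst hu
      obtain ⟨a, h1, h2⟩ := isTangle_append.1 hl.1
      obtain ⟨b, h3, h4⟩ := isTangle_append.1 hr.1
      rw [List.nil_append] at h1 h3
      cases h <;> simp [IsTangle, Kind.ins, Kind.outs] at h1 h3
      -- All other moves need strands that do not yet exist at the bottom; this one must exchange
      -- two minima.
      case exchange k k' i j hij =>
        obtain ⟨⟨rfl, hk⟩, h1⟩ := h1
        obtain ⟨⟨⟨rfl, hk1⟩, hk'⟩, h3⟩ := h3
        obtain rfl : k = .cup := by cases k <;> simp at hk ⊢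
        obtain rfl : k' = .cup := by cases k' <;> simp at hk' ⊢
        -- The two sides fix the direction at different minima. They share one state above both
        -- minima, and their other states are reverses of each other.
        have hrev := orientationSum_not (A : R) ((A⁻¹ : Rˣ) : R) c v [false, true, true, false]
        simp only [List.map_cons, List.map_nil, Bool.not_true, Bool.not_false] at hrev
        simp [halfOrientationSum, orientationSum, transfer, layerTransfer, kindTransfer,
          Kind.ins, Kind.outs] at hrev ⊢
        rw [hrev]
    · obtain ⟨u, k, m, rfl, hu, hl', -⟩ := exists_split hl.1 hu
      obtain ⟨u', k', m', hu', hu'', hr', -⟩ := exists_split hr.1 (by simp)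
      obtain rfl := (List.cons_eq_cons.1 hu').2
      obtain rfl := isTangle_unique hu hu''
      exact orientationSum_congr_middle _ _ _ v _ hu fun f t ht =>
        transfer_regularMove _ _ c A.mul_inv h hl' hr' f t ht
  skein u v i h := by
    by_cases hu : u = []
    · subst hu
      simp [IsLink, IsDiagram, IsTangle, Kind.ins] at h
    obtain ⟨u, k, m, rfl, hu, hl, -⟩ := exists_split h.1 hu
    simp only [halfOrientationSum, orientationSum, transfer_append, List.cons_append,
      List.tail_cons]
    rw [← transfer_sub, ← transfer_sub, ← transfer_mul]
    refine transfer_congr _ _ _ _ _ _ hu fun t ht => ?_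
    refine transfer_skein _ _ _ i _ t ?_
    rw [ht]
    exact hl.1
  curl u v i h := by
    by_cases hu : u = []
    · subst hu
      simp [IsLink, IsDiagram, IsTangle, Kind.ins] at h
    obtain ⟨u, k, m, rfl, hu, hl, -⟩ := exists_split h.1 hu
    simp only [halfOrientationSum, orientationSum, transfer_append, List.cons_append,
      List.tail_cons]
    rw [← transfer_mul]
    exact transfer_congr _ _ _ _ _ _ hu fun t ht =>
      (transfer_curl _ _ _ i _ t (ht ▸ hl.1)).1
  curlInv u v i h := by
    by_cases hu : u = []
    · subst hu
      simp [IsLink, IsDiagram, IsTangle, Kind.ins] at h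
    obtain ⟨u, k, m, rfl, hu, hl, -⟩ := exists_split h.1 hu
    simp only [halfOrientationSum, orientationSum, transfer_append, List.cons_append,
      List.tail_cons]
    rw [← transfer_mul]
    exact transfer_congr _ _ _ _ _ _ hu fun t ht =>
      (transfer_curl _ _ _ i _ t (ht ▸ hl.1)).2
  unknot := by
    simp [halfOrientationSum, orientationSum, transfer, layerTransfer, kindTransfer]

/-! ### Reducing planar 4-valent graphs to bigons, curls and circles -/

/-- Local moves on planar 4-valent graphs that are shadows of regular isotopies, in the directions
in which they do not create pieces. -/
inductive ShadowMove : List Layer → List Layer → Prop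
  | lower (k k' : Kind) (i j : ℕ) (hij : i ≤ j) :
      ShadowMove [⟨k, i⟩, ⟨k', j + k.outs⟩] [⟨k', j + k.ins⟩, ⟨k, i⟩]
  | raise (k k' : Kind) (i j : ℕ) (hij : i ≤ j) :
      ShadowMove [⟨k', j + k.ins⟩, ⟨k, i⟩] [⟨k, i⟩, ⟨k', j + k.outs⟩]
  | zigzagLeft (i : ℕ) : ShadowMove [cup i, cap (i + 1)] []
  | zigzagRight (i : ℕ) : ShadowMove [cup (i + 1), cap i] []
  | capRight (i : ℕ) : ShadowMove [vertex (i + 1), cap i] [vertex i, cap (i + 1)]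
  | capLeft (i : ℕ) : ShadowMove [vertex i, cap (i + 1)] [vertex (i + 1), cap i]
  | cupRight (i : ℕ) : ShadowMove [cup i, vertex (i + 1)] [cup (i + 1), vertex i]
  | cupLeft (i : ℕ) : ShadowMove [cup (i + 1), vertex i] [cup i, vertex (i + 1)]
  | braid (i : ℕ) : ShadowMove [vertex i, vertex (i + 1), vertex i]
      [vertex (i + 1), vertex i, vertex (i + 1)]

/-- Reachability under `ShadowMove`. -/
inductive Reduces : List Layer → List Layer → Prop
  | refl (w : List Layer) : Reduces w w
  | head {l r w : List Layer} (u v : List Layer) (h : ShadowMove l r)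
      (h' : Reduces (u ++ r ++ v) w) : Reduces (u ++ l ++ v) w

/-- The graphs at which an invariant of shadows vanishes if it does so at the circle, is zero in
the presence of a bigon or a curl, and is multiplied by some factor when a circle is added. -/
inductive Null : List Layer → Prop
  | bigon (u v : List Layer) (i : ℕ) : Null (u ++ [vertex i, vertex i] ++ v)
  | curlCup (u v : List Layer) (i : ℕ) : Null (u ++ [cup i, vertex i] ++ v)
  | curlCap (u v : List Layer) (i : ℕ) : Null (u ++ [vertex i, cap i] ++ v)
  | circle (u v : List Layer) (i : ℕ) (h : u ++ v ≠ [] → Null (u ++ v)) :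
      Null (u ++ [cup i, cap i] ++ v)
  | move {l r : List Layer} (u v : List Layer) (h : ShadowMove l r) (h' : Null (u ++ r ++ v)) :
      Null (u ++ l ++ v)

lemma ShadowMove.isTangle {l r : List Layer} (h : ShadowMove l r) {n m : ℕ}
    (hl : IsTangle n l m) : IsTangle n r m := by
  cases h
  case lower k k' i j hij => simp only [IsTangle] at hl ⊢; omega
  case raise k k' i j hij => simp only [IsTangle] at hl ⊢; omega
  all_goals
    simp [IsTangle, Kind.ins, Kind.outs] at hl ⊢
    omega

lemma ShadowMove.kind {l r : List Layer} (h : ShadowMove l r) {P : Kind → Prop}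
    (hl : ∀ x ∈ l, P x.kind) : ∀ x ∈ r, P x.kind := by
  cases h <;> simp_all

namespace Reduces

lemma trans {w w' w'' : List Layer} (h : Reduces w w') (h' : Reduces w' w'') :
    Reduces w w'' := by
  induction h with
  | refl => exact h'
  | head u v h _ ih => exact .head u v h (ih h')

lemma of_move {l r : List Layer} (h : ShadowMove l r) : Reduces l r := by
  simpa using head [] [] h (.refl _)

lemma append {w w' : List Layer} (h : Reduces w w') (u v : List Layer) :
    Reduces (u ++ w ++ v) (u ++ w' ++ v) := by
  induction h with
  | refl => exact .refl _
  | head a b h _ ih =>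
    have := head (u ++ a) (b ++ v) h (w := u ++ _ ++ v) (by simpa using ih)
    simpa using this

lemma left {w w' : List Layer} (h : Reduces w w') (u : List Layer) :
    Reduces (u ++ w) (u ++ w') := by
  simpa using h.append u []

lemma right {w w' : List Layer} (h : Reduces w w') (v : List Layer) :
    Reduces (w ++ v) (w' ++ v) := by
  simpa using h.append [] v

lemma isTangle {w w' : List Layer} (h : Reduces w w') {n m : ℕ} (hw : IsTangle n w m) :
    IsTangle n w' m := by
  induction h with
  | refl => exact hw
  | head u v h _ ih => exact ih (isTangle_replace (fun _ _ => h.isTangle) hw)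

lemma kind {w w' : List Layer} (h : Reduces w w') {P : Kind → Prop}
    (hw : ∀ x ∈ w, P x.kind) : ∀ x ∈ w', P x.kind := by
  induction h with
  | refl => exact hw
  | head u v h _ ih =>
    refine ih ?_
    have := h.kind (P := P)
    simp only [List.mem_append] at hw ⊢
    aesop

lemma null {w w' : List Layer} (h : Reduces w w') (hw : Null w') : Null w := by
  induction h with
  | refl => exact hw
  | head u v h _ ih => exact .move u v h (ih hw)

lemma isPlanarGraph {w w' : List Layer} (h : Reduces w w') (hw : IsPlanarGraph w) :
    IsPlanarGraph w' :=
  ⟨h.isTangle hw.1, h.kind (P := fun k => k ≠ .crossNW ∧ k ≠ .crossNE) hw.2⟩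

end Reduces

/-! ### Pulling an arc upwards through the diagram -/

/-- The vertices at the positions `i`, `i + 1`, ..., `i + k - 1`. -/
def ladder (i k : ℕ) : List Layer := (List.range' i k).map vertex

lemma ladder_zero (i : ℕ) : ladder i 0 = [] := rfl

lemma ladder_succ (i k : ℕ) : ladder i (k + 1) = vertex i :: ladder (i + 1) k := by
  simp [ladder, List.range'_succ]

lemma ladder_concat (i k : ℕ) : ladder i (k + 1) = ladder i k ++ [vertex (i + k)] := by
  simp [ladder, List.range'_concat]

lemma ladder_add (i k l : ℕ) : ladder i (k + l) = ladder i k ++ ladder (i + k) l := by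
  induction l with
  | zero => simp [ladder_zero]
  | succ l ih => rw [← add_assoc, ladder_concat, ladder_concat, ih, List.append_assoc, add_assoc]

lemma ladder_lower_left (k : Kind) {p d : ℕ} (h : p ≤ d) (n : ℕ) :
    Reduces (ladder (d + k.ins) n ++ [⟨k, p⟩]) (⟨k, p⟩ :: ladder (d + k.outs) n) := by
  induction n generalizing d with
  | zero => exact .refl _
  | succ n ih =>
    rw [ladder_succ, ladder_succ]
    have h1 := (ih (d := d + 1) (by omega)).left [vertex (d + k.ins)]
    rw [show d + 1 + k.ins = d + k.ins + 1 by omega,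
      show d + 1 + k.outs = d + k.outs + 1 by omega] at h1
    have h2 := (Reduces.of_move (.raise k .vertex p d h)).right (ladder (d + k.outs + 1) n)
    exact Reduces.trans (by simpa using h1) (by simpa using h2)

lemma ladder_lower_right (k : Kind) {p i n : ℕ} (h : i + n + 1 ≤ p) :
    Reduces (ladder i n ++ [⟨k, p⟩]) (⟨k, p⟩ :: ladder i n) := by
  induction n with
  | zero => exact .refl _
  | succ n ih =>
    rw [ladder_concat]
    obtain ⟨q, rfl⟩ : ∃ q, p = q + 2 := ⟨p - 2, by omega⟩
    have h1 := (Reduces.of_move (.lower .vertex k (i + n) q (by omega))).left (ladder i n)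
    have h2 := (ih (by omega)).right [vertex (i + n)]
    exact Reduces.trans (by simpa [Kind.ins, Kind.outs] using h1) (by simpa using h2)

/-- The ladder is one strand running to the right, and each strand it crosses moves one place to the
left; hence the shift of the vertex. One triangle move suffices, the rest being exchanges. -/
lemma ladder_lower_inner (i : ℕ) {t n : ℕ} (h : t + 1 < n) :
    Reduces (ladder i n ++ [vertex (i + t)]) (vertex (i + t + 1) :: ladder i n) := by
  obtain ⟨m, rfl⟩ : ∃ m, n = t + (m + 2) := ⟨n - t - 2, by omega⟩
  rw [ladder_add, ladder_succ, ladder_succ]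
  have h1 := (ladder_lower_left .vertex (le_refl (i + t)) m).left
    (ladder i t ++ [vertex (i + t), vertex (i + t + 1)])
  have h2 := (Reduces.of_move (.braid (i + t))).append (ladder i t) (ladder (i + t + 2) m)
  have h3 := (ladder_lower_right .vertex (p := i + t + 1) (i := i) (n := t) (by omega)).right
    (vertex (i + t) :: vertex (i + t + 1) :: ladder (i + t + 2) m)
  simp only [Kind.ins, Kind.outs] at h1
  exact Reduces.trans (by simpa using h1) (Reduces.trans (by simpa using h2) (by simpa using h3))

/-- The maximum joins two strands that both cross the ladder. Rotating one of these crossings past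
the maximum turns the two crossings into a bigon. -/
lemma null_ladder_cap (i : ℕ) {t n : ℕ} (h : t + 1 < n) (u v : List Layer) :
    Null (u ++ (ladder i n ++ [cap (i + t)]) ++ v) := by
  obtain ⟨m, rfl⟩ : ∃ m, n = t + (m + 2) := ⟨n - t - 2, by omega⟩
  rw [ladder_add, ladder_succ, ladder_succ]
  have h1 := (ladder_lower_left .cap (le_refl (i + t)) m).append
    (u ++ ladder i t ++ [vertex (i + t), vertex (i + t + 1)]) v
  have h2 := (Reduces.of_move (.capRight (i + t))).append (u ++ ladder i t ++ [vertex (i + t)])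
    (ladder (i + t) m ++ v)
  have h3 := Null.bigon (u ++ ladder i t) (cap (i + t + 1) :: ladder (i + t) m ++ v) (i + t)
  simp only [Kind.ins, Kind.outs] at h1
  exact Reduces.null (by simpa using h1) (Reduces.null (by simpa using h2) (by simpa using h3))

/-- An arc open to the top with left foot `j` that is crossed once by each of the `k` strands that
pass through it. -/
def arc (j k : ℕ) : List Layer := cup j :: ladder (j + 1) k

lemma arc_lower_left (k : Kind) {p d : ℕ} (h : p ≤ d) (n : ℕ) :
    Reduces (arc (d + k.ins) n ++ [⟨k, p⟩]) (⟨k, p⟩ :: arc (d + k.outs) n) := by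
  have h1 := (ladder_lower_left k (show p ≤ d + 1 by omega) n).left [cup (d + k.ins)]
  rw [show d + 1 + k.ins = d + k.ins + 1 by omega,
    show d + 1 + k.outs = d + k.outs + 1 by omega] at h1
  have h2 := (Reduces.of_move (.raise k .cup p d h)).right (ladder (d + k.outs + 1) n)
  exact Reduces.trans (by simpa [arc] using h1) (by simpa [arc] using h2)

lemma arc_lower_right (k : Kind) {p j n : ℕ} (h : j + n ≤ p) :
    Reduces (arc j n ++ [⟨k, p + 2⟩]) (⟨k, p⟩ :: arc j n) := by
  have h1 := (ladder_lower_right k (p := p + 2) (i := j + 1) (n := n) (by omega)).left [cup j]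
  have h2 := (Reduces.of_move (.lower .cup k j p (by omega))).right (ladder (j + 1) n)
  exact Reduces.trans (by simpa [arc] using h1) (by simpa [arc, Kind.ins, Kind.outs] using h2)

lemma arc_lower_inner (j : ℕ) {t n : ℕ} (h : t + 1 < n) :
    Reduces (arc j n ++ [vertex (j + 1 + t)]) (vertex (j + t) :: arc j n) := by
  have h1 := (ladder_lower_inner (j + 1) h).left [cup j]
  have h2 := (Reduces.of_move (.lower .cup .vertex j (j + t) (by omega))).right (ladder (j + 1) n)
  rw [show j + 1 + t + 1 = j + t + 2 by omega] at h1
  exact Reduces.trans (by simpa [arc] using h1) (by simpa [arc, Kind.ins, Kind.outs] using h2)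

lemma arc_extend_left (j n : ℕ) :
    Reduces (arc (j + 1) n ++ [vertex j]) (arc j (n + 1)) := by
  have h1 := (ladder_lower_left .vertex (le_refl j) n).left [cup (j + 1)]
  have h2 := (Reduces.of_move (.cupLeft j)).right (ladder (j + 2) n)
  simp only [Kind.ins, Kind.outs] at h1
  exact Reduces.trans (by simpa [arc] using h1) (by simpa [arc, ladder_succ] using h2)

lemma arc_extend_right (j n : ℕ) : arc j n ++ [vertex (j + 1 + n)] = arc j (n + 1) := by
  simp [arc, ladder_concat]

/-- With nothing passing through the arc its two legs meet in a curl. Otherwise the first strand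
meets both legs, and rotating its crossing around the minimum yields a bigon. -/
lemma null_arc_vertex_left (j n : ℕ) (u v : List Layer) : Null (u ++ (arc j n ++ [vertex j]) ++ v) := by
  cases n with
  | zero => exact .curlCup u v j
  | succ n =>
    have h1 := (ladder_lower_left .vertex (le_refl j) n).append (u ++ [cup j, vertex (j + 1)]) v
    have h2 := (Reduces.of_move (.cupRight j)).append u (vertex j :: ladder (j + 2) n ++ v)
    have h3 := Null.bigon (u ++ [cup (j + 1)]) (ladder (j + 2) n ++ v) j
    simp only [Kind.ins, Kind.outs] at h1
    exact Reduces.null (by simpa [arc, ladder_succ] using h1)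
      (Reduces.null (by simpa using h2) (by simpa using h3))

lemma null_arc_vertex_right (j n : ℕ) (u v : List Layer) :
    Null (u ++ (arc j (n + 1) ++ [vertex (j + 1 + n)]) ++ v) := by
  simpa [arc, ladder_concat] using Null.bigon (u ++ cup j :: ladder (j + 1) n) v (j + 1 + n)

/-- The strand now joined to the left leg also crosses the right leg, which closes a curl. -/
lemma null_arc_cap_left (j n : ℕ) (u v : List Layer) :
    Null (u ++ (arc j (n + 1) ++ [cap j]) ++ v) := by
  have h1 := (ladder_lower_left .cap (le_refl j) n).append (u ++ [cup j, vertex (j + 1)]) v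
  have h2 := (Reduces.of_move (.capRight j)).append (u ++ [cup j]) (ladder j n ++ v)
  have h3 := Null.curlCup u (cap (j + 1) :: ladder j n ++ v) j
  simp only [Kind.ins, Kind.outs] at h1
  exact Reduces.null (by simpa [arc, ladder_succ] using h1)
    (Reduces.null (by simpa using h2) (by simpa using h3))

lemma null_arc_cap_right (j n : ℕ) (u v : List Layer) :
    Null (u ++ (arc j (n + 1) ++ [cap (j + 1 + n)]) ++ v) := by
  simpa [arc, ladder_concat] using Null.curlCap (u ++ cup j :: ladder (j + 1) n) v (j + 1 + n)

lemma null_arc_cap_inner (j : ℕ) {t n : ℕ} (h : t + 1 < n) (u v : List Layer) :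
    Null (u ++ (arc j n ++ [cap (j + 1 + t)]) ++ v) := by
  simpa [arc] using null_ladder_cap (j + 1) h (u ++ [cup j]) v

lemma arc_zigzag_left (j n : ℕ) : Reduces (arc (j + 1) n ++ [cap j]) (ladder j n) := by
  have h1 := (ladder_lower_left .cap (le_refl j) n).left [cup (j + 1)]
  have h2 := (Reduces.of_move (.zigzagRight j)).right (ladder j n)
  simp only [Kind.ins, Kind.outs] at h1
  exact Reduces.trans (by simpa [arc] using h1) (by simpa using h2)

/-- The surviving vertices appear at descending positions, so they do not form a `ladder`; only
their number matters, to see that the diagram becomes shorter. -/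
lemma arc_zigzag_right (j n : ℕ) :
    ∃ w, Reduces (arc j n ++ [cap (j + 1 + n)]) w ∧ w.length = n := by
  induction n with
  | zero => exact ⟨[], .of_move (.zigzagLeft j), rfl⟩
  | succ n ih =>
    obtain ⟨w, hw, hn⟩ := ih
    refine ⟨vertex (j + n) :: w, ?_, by simp [hn]⟩
    have h1 := (Reduces.of_move (.capLeft (j + 1 + n))).left (arc j n)
    have h2 := (arc_lower_right .vertex (le_refl (j + n))).right [cap (j + 1 + n)]
    have h3 := hw.left [vertex (j + n)]
    rw [← arc_extend_right]
    rw [show j + 1 + n + 1 = j + n + 2 by omega] at h1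
    rw [show j + 1 + (n + 1) = j + n + 2 by omega]
    exact Reduces.trans (by simpa using h1) (Reduces.trans (by simpa using h2) (by simpa using h3))

lemma isTangle_ladder {i n a b : ℕ} (h : IsTangle a (ladder i n) b) : b = a := by
  induction n generalizing i a with
  | zero => exact h.symm
  | succ n ih =>
    rw [ladder_succ] at h
    have h1 := h.1
    have := ih h.2
    simp only [Kind.ins, Kind.outs] at this h1
    omega

lemma length_arc (j n : ℕ) : (arc j n).length = n + 1 := by simp [arc, ladder]

/-- If nothing but vertices and maxima lie above an arc, it can be pulled up until it closes or
is straightened, unless there are a bigon or a curl. -/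
lemma null_of_arc {L : ℕ} (ih : ∀ w : List Layer, w.length < L → IsPlanarGraph w → w ≠ [] → Null w)
    (v : List Layer) (hv : ∀ x ∈ v, x.kind ≠ .cup) (u : List Layer) (j n : ℕ)
    (hw : IsPlanarGraph (u ++ arc j n ++ v)) (hL : (u ++ arc j n ++ v).length = L) :
    Null (u ++ arc j n ++ v) := by
  induction v generalizing u j n with
  | nil =>
    -- Both legs of the arc are still open, so the diagram cannot end here.
    exfalso
    obtain ⟨a, -, b, h2, h3⟩ := by simpa only [IsDiagram, List.append_assoc, isTangle_append] using hw.1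
    have h4 := isTangle_ladder h2.2
    simp [IsTangle, Kind.ins, Kind.outs] at h3 h4
    omega
  | cons x v ihv =>
    have hx := hv x (by simp)
    have hv' : ∀ y ∈ v, y.kind ≠ .cup := fun y hy => hv y (by simp [hy])
    have hxc := hw.2 x (by simp)
    -- The next piece slips below the arc or becomes a vertex on it. The total length is unchanged
    -- and `v` loses a layer, so the inner induction applies.
    have push : ∀ (g : List Layer) (j' n' : ℕ), Reduces (arc j n ++ [x]) (g ++ arc j' n') →
        g.length + n' = n + 1 → Null (u ++ arc j n ++ x :: v) := by
      intro g j' n' h hn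
      have h' := h.append u v
      have h0 : u ++ (arc j n ++ [x]) ++ v = u ++ arc j n ++ x :: v := by simp
      rw [h0] at h'
      refine h'.null ?_
      have := ihv hv' (u ++ g) j' n' (by simpa using h'.isPlanarGraph hw) (by
        simp only [List.length_append, length_arc, List.length_cons] at hL ⊢; omega)
      simpa using this
    have kill : (∀ u v, Null (u ++ (arc j n ++ [x]) ++ v)) → Null (u ++ arc j n ++ x :: v) :=
      fun h => by simpa using h u v
    -- Straightening the arc lowers the length, so the outer induction applies; `u ≠ []` keeps the
    -- remaining diagram nonempty.
    have shorten : ∀ w, Reduces (arc j n ++ [x]) w → w.length = n → u ≠ [] →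
        Null (u ++ arc j n ++ x :: v) := by
      intro w h hn hu
      have h' := h.append u v
      have h0 : u ++ (arc j n ++ [x]) ++ v = u ++ arc j n ++ x :: v := by simp
      rw [h0] at h'
      refine h'.null (ih _ ?_ (h'.isPlanarGraph hw) (by simp [hu]))
      simp only [List.length_append, length_arc, List.length_cons] at hL ⊢; omega
    obtain ⟨k, p⟩ := x
    obtain ⟨a, h1, b, h2, h3⟩ := by
      simpa only [IsDiagram, List.append_assoc, isTangle_append] using hw.1
    have hja : j ≤ a := h2.1
    have hb := isTangle_ladder h2.2
    simp only [Kind.ins, Kind.outs] at hb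
    have hp := h3.1
    -- The legs of the arc stand at `j` and `j + n + 1`. The cases are: the piece lies outside the
    -- arc, touches a leg from outside or from inside, or lies strictly between the legs.
    rcases lt_or_ge (p + 1) j with hlt | hge
    · cases k <;> simp at hx hxc
      case vertex =>
        obtain ⟨d, rfl⟩ : ∃ d, j = d + 2 := ⟨j - 2, by omega⟩
        exact push [_] _ _ (arc_lower_left .vertex (show p ≤ d by omega) n) (by simp [add_comm])
      case cap =>
        obtain ⟨d, rfl⟩ : ∃ d, j = d + 2 := ⟨j - 2, by omega⟩
        exact push [_] _ _ (arc_lower_left .cap (show p ≤ d by omega) n) (by simp [add_comm])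
    rcases lt_or_ge (j + n + 1) p with hlt' | hge'
    · obtain ⟨q, rfl⟩ : ∃ q, p = q + 2 := ⟨p - 2, by omega⟩
      exact push [_] _ _ (arc_lower_right k (by omega)) (by simp [add_comm])
    rcases hge.eq_or_lt with rfl | hgt
    · cases k <;> simp at hx hxc
      case vertex => exact push [] _ _ (arc_extend_left p n) (by simp)
      case cap =>
        refine shorten _ (arc_zigzag_left p n) (by simp [ladder]) ?_
        rintro rfl
        simp only [IsTangle] at h1
        omega
    rcases (show j ≤ p by omega).eq_or_lt with rfl | hjp
    · cases k <;> simp at hx hxc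
      case vertex => exact kill (null_arc_vertex_left j n)
      case cap =>
        cases n with
        | zero =>
          -- No strand passes through the arc and the maximum joins its legs: a circle, whose
          -- removal shortens the diagram.
          have := Null.circle u v j fun hne => ?_
          · simpa [arc, ladder_zero] using this
          have hd : IsDiagram (u ++ v) := by
            refine isTangle_append.2 ⟨a, h1, ?_⟩
            have := h3.2
            simp only [Kind.ins, Kind.outs] at this
            convert this using 1
            omega
          refine ih _ ?_ ⟨hd, fun y hy => hw.2 y ?_⟩ hne
          · simp only [List.length_append, length_arc, List.length_cons] at hL ⊢; omega
          · simp only [List.mem_append, List.mem_cons] at hy ⊢; tauto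
        | succ n => exact kill (null_arc_cap_left j n)
    rcases hge'.eq_or_lt with rfl | hlt'
    · cases k <;> simp at hx hxc
      case vertex =>
        rw [show j + n + 1 = j + 1 + n by omega] at push ⊢
        refine push [] j (n + 1) ?_ (by simp)
        rw [arc_extend_right]
        exact .refl _
      case cap =>
        rw [show j + n + 1 = j + 1 + n by omega] at shorten ⊢
        obtain ⟨w, h, hn⟩ := arc_zigzag_right j n
        refine shorten _ h hn ?_
        rintro rfl
        simp only [IsTangle, Kind.ins] at h1 hp
        omega
    obtain ⟨t, rfl⟩ : ∃ t, p = j + 1 + t := ⟨p - j - 1, by omega⟩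
    rcases (show t + 1 ≤ n by omega).eq_or_lt with rfl | htn
    · cases k <;> simp at hx hxc
      case vertex => exact kill (null_arc_vertex_right j t)
      case cap => exact kill (null_arc_cap_right j t)
    · cases k <;> simp at hx hxc
      case vertex => exact push [_] _ _ (arc_lower_inner j htn) (by simp [add_comm])
      case cap => exact kill (null_arc_cap_inner j htn)

lemma exists_last_cup (w : List Layer) (h : ∃ x ∈ w, x.kind = .cup) :
    ∃ u j v, w = u ++ arc j 0 ++ v ∧ ∀ x ∈ v, x.kind ≠ .cup := by
  induction w with
  | nil => simp at h
  | cons x w ih =>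
    by_cases hw : ∃ x ∈ w, x.kind = .cup
    · obtain ⟨u, j, v, rfl, hv⟩ := ih hw
      exact ⟨x :: u, j, v, by simp, hv⟩
    · push Not at hw
      obtain ⟨y, hy, hk⟩ := h
      rcases List.mem_cons.1 hy with rfl | hy
      · obtain ⟨k, j⟩ := y
        obtain rfl : k = .cup := hk
        exact ⟨[], j, w, by simp [arc, ladder_zero], hw⟩
      · exact absurd hk (hw y hy)

/-- Only vertices and maxima lie above the highest minimum, so that minimum can serve as the arc to
be pulled up. The recursion is on the number of layers. -/
theorem null_of_isPlanarGraph (w : List Layer) (hw : IsPlanarGraph w) (hne : w ≠ []) : Null w := by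
  induction hL : w.length using Nat.strong_induction_on generalizing w with
  | _ L ih =>
    obtain ⟨w', rfl, -⟩ := exists_eq_cup_cons hw.1 hne
    obtain ⟨u, j, v, h, hv⟩ := exists_last_cup (cup 0 :: w') ⟨_, List.mem_cons_self, rfl⟩
    rw [h] at hw hL ⊢
    exact null_of_arc (fun w hlt h1 h2 => ih _ hlt w h1 h2 rfl) v hv u j 0 hw hL

/-! ### Uniqueness of the Dubrovnik polynomial -/

/-- The relations of a Dubrovnik polynomial, except that the value at the unknot is `0`; they hold
for the difference of two Dubrovnik polynomials. -/
structure IsDubrovnikDifference {R : Type*} [CommRing R] (a : Rˣ) (z : R) (E : List Layer → R) :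
    Prop where
  regularIsotopy : ∀ l r u v : List Layer, RegularMove l r →
    IsLink (u ++ l ++ v) → IsLink (u ++ r ++ v) → E (u ++ l ++ v) = E (u ++ r ++ v)
  skein : ∀ (u v : List Layer) (i : ℕ), IsLink (u ++ [crossNE i] ++ v) →
    E (u ++ [crossNE i] ++ v) - E (u ++ [crossNW i] ++ v) =
      z * (E (u ++ v) - E (u ++ [cap i, cup i] ++ v))
  curl : ∀ (u v : List Layer) (i : ℕ), IsLink (u ++ [cup (i + 1), crossNE i, cap (i + 1)] ++ v) →
    E (u ++ [cup (i + 1), crossNE i, cap (i + 1)] ++ v) = (a : R) * E (u ++ v)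
  curlInv : ∀ (u v : List Layer) (i : ℕ), IsLink (u ++ [cup (i + 1), crossNW i, cap (i + 1)] ++ v) →
    E (u ++ [cup (i + 1), crossNW i, cap (i + 1)] ++ v) = ((a⁻¹ : Rˣ) : R) * E (u ++ v)
  unknot : E [cup 0, cap 0] = 0

lemma IsDubrovnik.sub {R : Type*} [CommRing R] {a : Rˣ} {z : R} {D D' : List Layer → R}
    (h : IsDubrovnik a z D) (h' : IsDubrovnik a z D') :
    IsDubrovnikDifference a z fun w => D w - D' w where
  regularIsotopy l r u v hm hl hr := by
    rw [h.regularIsotopy l r u v hm hl hr, h'.regularIsotopy l r u v hm hl hr]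
  skein u v i hl := by linear_combination h.skein u v i hl - h'.skein u v i hl
  curl u v i hl := by linear_combination h.curl u v i hl - h'.curl u v i hl
  curlInv u v i hl := by linear_combination h.curlInv u v i hl - h'.curlInv u v i hl
  unknot := by rw [h.unknot, h'.unknot, sub_self]

lemma isLink_replace {l r u v : List Layer} (h : IsLink (u ++ l ++ v))
    (ht : ∀ a b, IsTangle a l b → IsTangle a r b) (hk : ∀ x ∈ r, x.kind ≠ .vertex) :
    IsLink (u ++ r ++ v) := by
  refine ⟨isTangle_replace ht h.1, fun x hx => ?_⟩
  have h2 := h.2 x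
  simp only [List.mem_append] at hx h2
  rcases hx with (hx | hx) | hx
  · exact h2 (by simp [hx])
  · exact hk x hx
  · exact h2 (by simp [hx])

lemma RegularMove.isTangle {l r : List Layer} (h : RegularMove l r) {n m : ℕ}
    (hl : IsTangle n l m) : IsTangle n r m := by
  cases h
  case exchange k k' i j hij => simp only [IsTangle] at hl ⊢; omega
  all_goals
    simp [IsTangle, Kind.ins, Kind.outs] at hl ⊢
    omega

/-- The empty word fits any number of strands, while the zigzags and second Reidemeister moves that
replace it need enough of them; hence `r ≠ []`. -/
lemma RegularMove.isTangle_symm {l r : List Layer} (h : RegularMove l r) (hne : r ≠ []) {n m : ℕ}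
    (hr : IsTangle n r m) : IsTangle n l m := by
  cases h
  case exchange k k' i j hij => simp only [IsTangle] at hr ⊢; omega
  all_goals first
    | exact absurd rfl hne
    | simp [IsTangle, Kind.ins, Kind.outs] at hr ⊢
      omega

lemma RegularMove.kind_iff {l r : List Layer} (h : RegularMove l r) :
    (∀ x ∈ l, x.kind ≠ .vertex) ↔ ∀ x ∈ r, x.kind ≠ .vertex := by
  cases h <;> simp [and_comm]

lemma IsLink.middle {u l v : List Layer} (h : IsLink (u ++ l ++ v)) : ∀ x ∈ l, x.kind ≠ .vertex :=
  fun x hx => h.2 x (by simp [hx])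

/-- Number of crossings and vertices. -/
def numNodes (w : List Layer) : ℕ := w.countP fun x => decide (x.kind ≠ .cup ∧ x.kind ≠ .cap)

lemma numNodes_append (u v : List Layer) : numNodes (u ++ v) = numNodes u + numNodes v :=
  List.countP_append

/-- The shadow of a piece. -/
def Kind.shadow : Kind → Kind
  | .cup => .cup
  | .cap => .cap
  | _ => .vertex

/-- A crossing with the given shadow. -/
def Kind.lift : Kind → Kind
  | .vertex => .crossNW
  | k => k

/-- The shadow of a layer. -/
def Layer.shadow (x : Layer) : Layer := ⟨x.kind.shadow, x.pos⟩

/-- A layer without vertices with the given shadow. -/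
def Layer.lift (x : Layer) : Layer := ⟨x.kind.lift, x.pos⟩

lemma Kind.ins_shadow (k : Kind) : k.shadow.ins = k.ins := by cases k <;> rfl
lemma Kind.outs_shadow (k : Kind) : k.shadow.outs = k.outs := by cases k <;> rfl
lemma Kind.lift_ne (k : Kind) : k.lift ≠ .vertex := by cases k <;> simp [Kind.lift]

lemma Layer.shadow_lift (x : Layer) : x.lift.shadow = x.shadow := by
  obtain ⟨k, i⟩ := x
  cases k <;> rfl

lemma map_shadow_lift (w : List Layer) : (w.map Layer.lift).map Layer.shadow = w.map Layer.shadow := by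
  simp [Function.comp_def, Layer.shadow_lift]

lemma isTangle_shadow {n m : ℕ} {w : List Layer} :
    IsTangle n (w.map Layer.shadow) m ↔ IsTangle n w m := by
  induction w generalizing n with
  | nil => rfl
  | cons x w ih =>
    simp only [List.map_cons, IsTangle, ih, Layer.shadow, Kind.ins_shadow, Kind.outs_shadow]

lemma isTangle_congr {n m : ℕ} {w w' : List Layer} (h : w.map Layer.shadow = w'.map Layer.shadow) :
    IsTangle n w m ↔ IsTangle n w' m := by
  rw [← isTangle_shadow, h, isTangle_shadow]

lemma numNodes_shadow (w : List Layer) : numNodes (w.map Layer.shadow) = numNodes w := by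
  rw [numNodes, List.countP_map]
  refine List.countP_congr fun x _ => ?_
  obtain ⟨k, i⟩ := x
  cases k <;> simp [Layer.shadow, Kind.shadow]

lemma numNodes_congr {w w' : List Layer} (h : w.map Layer.shadow = w'.map Layer.shadow) :
    numNodes w = numNodes w' := by
  rw [← numNodes_shadow, h, numNodes_shadow]

lemma isLink_lift {w : List Layer} (h : IsDiagram w) : IsLink (w.map Layer.lift) := by
  refine ⟨(isTangle_congr (map_shadow_lift w)).2 h, fun x hx => ?_⟩
  obtain ⟨y, -, rfl⟩ := List.mem_map.1 hx
  exact y.kind.lift_ne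

lemma isLink_of_shadow {w w' : List Layer} (h : IsLink w)
    (hs : w.map Layer.shadow = w'.map Layer.shadow) (hk : ∀ x ∈ w', x.kind ≠ .vertex) :
    IsLink w' := ⟨(isTangle_congr hs).1 h.1, hk⟩

lemma isPlanarGraph_shadow {w : List Layer} (h : IsDiagram w) :
    IsPlanarGraph (w.map Layer.shadow) := by
  refine ⟨isTangle_shadow.2 h, fun x hx => ?_⟩
  obtain ⟨⟨k, i⟩, -, rfl⟩ := List.mem_map.1 hx
  cases k <;> simp [Layer.shadow, Kind.shadow]

lemma ne_nil_of_isTangle {u : List Layer} {k : ℕ} (h : IsTangle 0 u k) (hk : 0 < k) : u ≠ [] := by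
  rintro rfl
  simp only [IsTangle] at h
  omega

lemma IsLink.width {u l v : List Layer} (h : IsLink (u ++ l ++ v)) :
    ∃ k m, IsTangle 0 u k ∧ IsTangle k l m ∧ IsTangle m v 0 := by
  obtain ⟨m, h1, h3⟩ := isTangle_append.1 h.1
  obtain ⟨k, h1, h2⟩ := isTangle_append.1 h1
  exact ⟨k, m, h1, h2, h3⟩

lemma IsLink.replace_middle {u l v : List Layer} {k m : ℕ} (h : IsLink (u ++ l ++ v))
    (hu : IsTangle 0 u k) (hv : IsTangle m v 0) (r : List Layer) (hr : ∀ x ∈ r, x.kind ≠ .vertex)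
    (ht : IsTangle k r m) : IsLink (u ++ r ++ v) := by
  refine ⟨isTangle_append.2 ⟨m, isTangle_append.2 ⟨k, hu, ht⟩, hv⟩, fun x hx => ?_⟩
  have h2 := h.2 x
  simp only [List.mem_append] at hx h2
  rcases hx with (hx | hx) | hx
  · exact h2 (by simp [hx])
  · exact hr x hx
  · exact h2 (by simp [hx])

/-- In link diagrams `l` can be replaced by `r` without changing the value of `E`. -/
def LocallyEq {R : Type*} (E : List Layer → R) (l r : List Layer) : Prop :=
  ∀ u v, IsLink (u ++ l ++ v) → IsLink (u ++ r ++ v) ∧ E (u ++ l ++ v) = E (u ++ r ++ v)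

namespace LocallyEq

variable {R : Type*} {E : List Layer → R}

lemma trans {l m r : List Layer} (h : LocallyEq E l m) (h' : LocallyEq E m r) : LocallyEq E l r :=
  fun u v hl => ⟨(h' u v (h u v hl).1).1, (h u v hl).2.trans (h' u v (h u v hl).1).2⟩

lemma append {l r : List Layer} (h : LocallyEq E l r) (a b : List Layer) :
    LocallyEq E (a ++ l ++ b) (a ++ r ++ b) := fun u v => by
  simpa using h (u ++ a) (b ++ v)

end LocallyEq

namespace IsDubrovnikDifference

variable {R : Type*} [CommRing R] {a : Rˣ} {z : R} {E : List Layer → R}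

lemma move (hE : IsDubrovnikDifference a z E) {l r : List Layer} (h : RegularMove l r) :
    LocallyEq E l r := fun u v hl =>
  have hr := isLink_replace hl (fun _ _ => h.isTangle) (h.kind_iff.1 hl.middle)
  ⟨hr, hE.regularIsotopy l r u v h hl hr⟩

lemma move_symm (hE : IsDubrovnikDifference a z E) {l r : List Layer} (h : RegularMove l r)
    (hne : r ≠ []) : LocallyEq E r l := fun u v hr =>
  have hl := isLink_replace hr (fun _ _ => h.isTangle_symm hne) (h.kind_iff.2 hr.middle)
  ⟨hl, (hE.regularIsotopy l r u v h hl hr).symm⟩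

/-- Take an ordinary curl on the right leg of the minimum, turn its crossing around its maximum,
slide it left and straighten. The quarter turn exchanges the kinds, so `crossNW` here carries the
factor of `crossNE` in `curl`. -/
lemma curl_cup (hE : IsDubrovnikDifference a z E) (u v : List Layer) (i : ℕ)
    (h : IsLink (u ++ [cup i, crossNW i] ++ v)) :
    E (u ++ [cup i, crossNW i] ++ v) = a * E (u ++ [cup i] ++ v) := by
  have h1 := (hE.move_symm (.overCap (i + 1)) (by simp)).append [cup i, cup (i + 2)] []
  have h2 := (hE.move (.exchange .cup .cup i i le_rfl)).append [] [crossNW (i + 2), cap (i + 1)]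
  have h3 := (hE.move (.exchange .cup .crossNW i i le_rfl)).append [cup i] [cap (i + 1)]
  have h4 := (hE.move (.zigzagLeft i)).append [cup i, crossNW i] []
  have h5 := ((h1.trans h2).trans h3).trans h4
  have hl : IsLink (u ++ [cup i, cup (i + 2), crossNE (i + 1), cap (i + 2)] ++ v) :=
    isLink_replace h (by intro a b; simp [IsTangle, Kind.ins, Kind.outs]; omega) (by simp)
  have h6 := (h5 u v hl).2
  have h7 := hE.curl (u ++ [cup i]) v (i + 1) (by simpa using hl)
  simp only [List.append_assoc, List.cons_append, List.nil_append, add_assoc,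
    Nat.reduceAdd] at h6 h7 ⊢
  rw [← h6, h7]

lemma curlInv_cup (hE : IsDubrovnikDifference a z E) (u v : List Layer) (i : ℕ)
    (h : IsLink (u ++ [cup i, crossNE i] ++ v)) :
    E (u ++ [cup i, crossNE i] ++ v) = ((a⁻¹ : Rˣ) : R) * E (u ++ [cup i] ++ v) := by
  have h1 := (hE.move_symm (.underCap (i + 1)) (by simp)).append [cup i, cup (i + 2)] []
  have h2 := (hE.move (.exchange .cup .cup i i le_rfl)).append [] [crossNE (i + 2), cap (i + 1)]
  have h3 := (hE.move (.exchange .cup .crossNE i i le_rfl)).append [cup i] [cap (i + 1)]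
  have h4 := (hE.move (.zigzagLeft i)).append [cup i, crossNE i] []
  have h5 := ((h1.trans h2).trans h3).trans h4
  have hl : IsLink (u ++ [cup i, cup (i + 2), crossNW (i + 1), cap (i + 2)] ++ v) :=
    isLink_replace h (by intro a b; simp [IsTangle, Kind.ins, Kind.outs]; omega) (by simp)
  have h6 := (h5 u v hl).2
  have h7 := hE.curlInv (u ++ [cup i]) v (i + 1) (by simpa using hl)
  simp only [List.append_assoc, List.cons_append, List.nil_append, add_assoc,
    Nat.reduceAdd] at h6 h7 ⊢
  rw [← h6, h7]

lemma curl_cap (hE : IsDubrovnikDifference a z E) (u v : List Layer) (i : ℕ)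
    (h : IsLink (u ++ [crossNW i, cap i] ++ v)) :
    E (u ++ [crossNW i, cap i] ++ v) = a * E (u ++ [cap i] ++ v) := by
  have h1 := (hE.move_symm (.exchange .cap .cap i i le_rfl) (by simp)).append
    [cup (i + 2), crossNE (i + 1)] []
  have h2 := (hE.move (.underCap i)).append [cup (i + 2)] [cap i]
  have h3 := (hE.move_symm (.exchange .crossNW .cup i i le_rfl) (by simp)).append
    [] [cap (i + 1), cap i]
  have h4 := (hE.move (.zigzagRight (i + 1))).append [crossNW i] [cap i]
  have h5 := ((h1.trans h2).trans h3).trans h4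
  have hl : IsLink (u ++ [cup (i + 2), crossNE (i + 1), cap (i + 2), cap i] ++ v) :=
    isLink_replace h (by intro a b; simp [IsTangle, Kind.ins, Kind.outs]; omega) (by simp)
  have h6 := (h5 u v hl).2
  have h7 := hE.curl u ([cap i] ++ v) (i + 1) (by simpa using hl)
  simp only [List.append_assoc, List.cons_append, List.nil_append, add_assoc,
    Nat.reduceAdd] at h6 h7 ⊢
  exact h6.symm.trans h7

/-- Apply the skein relation to a curl on the strand left of the circle. The two curls and one
smoothing reduce to `u ++ v`, where `E` vanishes, leaving `z` times the value with the circle. -/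
lemma circle_right (hE : IsDubrovnikDifference a z E) (hz : z ∈ nonZeroDivisors R)
    {u v : List Layer} {i : ℕ} (h : IsLink (u ++ [cup (i + 1), cap (i + 1)] ++ v))
    (h0 : E (u ++ v) = 0) (hi : ∀ k, IsTangle 0 u k → i < k) :
    E (u ++ [cup (i + 1), cap (i + 1)] ++ v) = 0 := by
  obtain ⟨k, m, hu, hk, hm⟩ := h.width
  have hik := hi k hu
  obtain rfl : k = m := by simp [IsTangle, Kind.ins, Kind.outs] at hk; omega
  have link := h.replace_middle hu hm
  have l1 := link [cup (i + 1), crossNE i, cap (i + 1)] (by simp)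
    (by simp [IsTangle, Kind.ins, Kind.outs]; omega)
  have l2 := link [cup (i + 1), crossNW i, cap (i + 1)] (by simp)
    (by simp [IsTangle, Kind.ins, Kind.outs]; omega)
  have l3 := link [cup (i + 1), cap i, cup i, cap (i + 1)] (by simp)
    (by simp [IsTangle, Kind.ins, Kind.outs]; omega)
  have e1 := hE.curl u v i l1
  have e2 := hE.curlInv u v i l2
  have e3 := ((((hE.move (.zigzagRight i)).append [] [cup i, cap (i + 1)]).trans
    (hE.move (.zigzagLeft i))) u v l3).2
  have e4 := hE.skein (u ++ [cup (i + 1)]) ([cap (i + 1)] ++ v) i (by simpa using l1)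
  simp only [List.append_assoc, List.cons_append, List.nil_append, h0, mul_zero] at e1 e2 e3 e4 ⊢
  rw [e1, e2, e3, sub_zero, sub_zero] at e4
  exact (mem_nonZeroDivisors_iff.1 hz).1 _ e4.symm

/-- The mirror argument uses loops to the left of a strand. Their factors are not among the axioms
and come from `curl_cup` and `curlInv_cup`. -/
lemma circle_left (hE : IsDubrovnikDifference a z E) (hz : z ∈ nonZeroDivisors R)
    {u v : List Layer} (h : IsLink (u ++ [cup 0, cap 0] ++ v))
    (h0 : E (u ++ v) = 0) (hi : ∀ k, IsTangle 0 u k → 0 < k) :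
    E (u ++ [cup 0, cap 0] ++ v) = 0 := by
  obtain ⟨k, m, hu, hk, hm⟩ := h.width
  have hik := hi k hu
  obtain rfl : k = m := by simp [IsTangle, Kind.ins, Kind.outs] at hk; omega
  have link := h.replace_middle hu hm
  have l1 := link [cup 0, crossNE 1, cap 0] (by simp)
    (by simp [IsTangle, Kind.ins, Kind.outs]; omega)
  have l2 := link [cup 0, crossNW 1, cap 0] (by simp)
    (by simp [IsTangle, Kind.ins, Kind.outs]; omega)
  have l3 := link [cup 0, cap 1, cup 1, cap 0] (by simp)
    (by simp [IsTangle, Kind.ins, Kind.outs]; omega)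
  have l4 := link [cup 0, cap 1] (by simp) (by simp [IsTangle, Kind.ins, Kind.outs]; omega)
  have z1 := (hE.move (.zigzagLeft 0) u v l4).2
  have e1 := ((hE.move (.underCap 0)).append [cup 0] []) u v l1
  have e2 := ((hE.move (.overCap 0)).append [cup 0] []) u v l2
  have c1 := hE.curl_cup u ([cap 1] ++ v) 0 (by simpa using e1.1)
  have c2 := hE.curlInv_cup u ([cap 1] ++ v) 0 (by simpa using e2.1)
  have e3 := ((((hE.move (.zigzagLeft 0)).append [] [cup 1, cap 0]).trans
    (hE.move (.zigzagRight 0))) u v l3).2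
  have e4 := hE.skein (u ++ [cup 0]) ([cap 0] ++ v) 1 (by simpa using l1)
  simp only [List.append_assoc, List.cons_append, List.nil_append, zero_add, h0] at *
  rw [e1.2, e2.2, c1, c2, z1, e3, mul_zero, mul_zero, sub_zero, sub_zero] at e4
  exact (mem_nonZeroDivisors_iff.1 hz).1 _ e4.symm

lemma circle (hE : IsDubrovnikDifference a z E) (hz : z ∈ nonZeroDivisors R)
    {u v : List Layer} {i : ℕ} (h : IsLink (u ++ [cup i, cap i] ++ v)) (hne : u ++ v ≠ [])
    (h0 : E (u ++ v) = 0) : E (u ++ [cup i, cap i] ++ v) = 0 := by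
  obtain ⟨k, m, hu, hk, hm⟩ := h.width
  have hik : i ≤ k := hk.1
  rcases i with _ | i
  · rcases Nat.eq_zero_or_pos k with rfl | hkp
    · rcases List.eq_nil_or_concat' u with rfl | ⟨u, x, rfl⟩
      · have hv : IsDiagram v := by
          obtain rfl : m = 0 := by simp [IsTangle, Kind.ins, Kind.outs] at hk; omega
          exact hm
        obtain ⟨v, rfl, -⟩ := exists_eq_cup_cons hv hne
        -- The circle is alone at its level and lowest of all. It is exchanged with the minimum
        -- above, ending up left of the legs of that minimum.
        have h1 := (hE.move (.exchange .cap .cup 0 0 le_rfl)).append [cup 0] []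
        have h2 := (hE.move (.exchange .cup .cup 0 0 le_rfl)).append [] [cap 0]
        have h3 := (h1.trans h2) [] v (by simpa [Kind.outs] using h)
        refine h3.2.trans (hE.circle_left hz (u := [cup 0]) (v := v) h3.1 (by simpa using h0) ?_)
        intro k hk
        simp [IsTangle, Kind.ins, Kind.outs] at hk
        omega
      · obtain ⟨k, hu1, hx⟩ := isTangle_append.1 hu
        obtain ⟨rfl, rfl⟩ : x = cap 0 ∧ k = 2 := by
          obtain ⟨kx, p⟩ := x
          cases kx <;> simp [IsTangle, Kind.ins, Kind.outs] at hx ⊢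
          omega
        -- The circle is alone at its level above a maximum. It is lowered to the right of the two
        -- legs of that maximum.
        have h1 := (hE.move (.exchange .cap .cup 0 0 le_rfl)).append [] [cap 0]
        have h2 := (hE.move (.exchange .cap .cap 0 0 le_rfl)).append [cup 2] []
        have h3 := (h1.trans h2) u v (by simpa [Kind.outs] using h)
        have h4 := h3.2
        simp only [List.append_assoc, List.cons_append, List.nil_append] at h4 h0 ⊢
        refine h4.trans ?_
        have := hE.circle_right hz (u := u) (v := cap 0 :: v) (i := 1) (by simpa [Kind.ins] using h3.1) h0 ?_
        · simpa [Kind.ins] using this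
        · intro k hk
          rw [isTangle_unique hk hu1]
          omega
    · refine hE.circle_left hz h h0 fun k' hk' => ?_
      rwa [isTangle_unique hk' hu]
  · refine hE.circle_right hz h h0 fun k' hk' => ?_
    rw [isTangle_unique hk' hu]
    omega

/-- If `E` vanishes at diagrams with fewer than `N` crossings, then at diagrams with `N` crossings
it only depends on the shadow. -/
lemma eq_of_shadow (hE : IsDubrovnikDifference a z E) {N : ℕ}
    (low : ∀ w, IsLink w → w ≠ [] → numNodes w < N → E w = 0) {w w' : List Layer} (hw : IsLink w)
    (hN : numNodes w = N) (hk : ∀ x ∈ w', x.kind ≠ .vertex)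
    (hs : w.map Layer.shadow = w'.map Layer.shadow) : E w = E w' := by
  -- Both smoothings lose a crossing, so `E` vanishes on them and the crossing may be switched.
  have skein : ∀ u v i, IsLink (u ++ [crossNE i] ++ v) → numNodes (u ++ [crossNE i] ++ v) = N →
      E (u ++ [crossNE i] ++ v) = E (u ++ [crossNW i] ++ v) := by
    intro u v i h hn
    obtain ⟨k, m, hu, hx, hv⟩ := h.width
    simp only [IsTangle, Kind.ins, Kind.outs] at hx
    obtain rfl : k = m := by omega
    have hne := ne_nil_of_isTangle hu (by omega)
    have l1 := h.replace_middle hu hv [] (by simp) rfl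
    have l2 := h.replace_middle hu hv [cap i, cup i] (by simp)
      (by simp [IsTangle, Kind.ins, Kind.outs]; omega)
    have hn1 : numNodes [crossNE i] = 1 := rfl
    have hn2 : numNodes [cap i, cup i] = 0 := rfl
    simp only [numNodes_append] at hn
    have e1 := low _ l1 (by simp [hne]) (by simp only [numNodes_append, hn1] at *; simp [numNodes] at *; omega)
    have e2 := low _ l2 (by simp [hne]) (by simp only [numNodes_append]; omega)
    rw [List.append_nil] at e1
    have := hE.skein u v i h
    rw [e1, e2, sub_zero, mul_zero] at this
    exact sub_eq_zero.1 this
  -- The prefix `u` collects the layers already switched.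
  suffices h : ∀ u, IsLink (u ++ w) → numNodes (u ++ w) = N → E (u ++ w) = E (u ++ w') from
    h [] hw hN
  clear hw hN
  induction w generalizing w' with
  | nil =>
    intro u _ _
    rw [List.map_eq_nil_iff.1 hs.symm]
  | cons x w ih =>
    intro u hw hN
    rcases w' with _ | ⟨x', w'⟩
    · simp at hs
    obtain ⟨hx, hs⟩ := List.cons_eq_cons.1 hs
    have h1 : E (u ++ x :: w) = E (u ++ x' :: w) := by
      obtain ⟨k, i⟩ := x
      obtain ⟨k', i'⟩ := x'
      have hk1 := hk ⟨k', i'⟩ (by simp)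
      have hk2 := hw.2 ⟨k, i⟩ (by simp)
      obtain ⟨hkk, rfl⟩ : k.shadow = k'.shadow ∧ i = i' := Layer.mk.inj hx
      have e := skein u w i
      simp only [List.append_assoc, List.cons_append, List.nil_append] at e
      cases k <;> cases k' <;> simp [Kind.shadow] at hkk hk1 hk2 <;> try rfl
      · have hs' : (u ++ crossNW i :: w).map Layer.shadow =
            (u ++ crossNE i :: w).map Layer.shadow := by simp [Layer.shadow, Kind.shadow]
        refine (e (isLink_of_shadow hw hs' ?_) (by rw [← numNodes_congr hs', hN])).symm
        intro y hy
        simp only [List.mem_append, List.mem_cons] at hy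
        rcases hy with hy | rfl | hy
        · exact hw.2 y (by simp [hy])
        · simp
        · exact hw.2 y (by simp [hy])
      · exact e hw hN
    have hs' : (u ++ x :: w).map Layer.shadow = (u ++ [x'] ++ w).map Layer.shadow := by
      simp [hx]
    have hl : IsLink (u ++ [x'] ++ w) := by
      refine isLink_of_shadow hw hs' fun y hy => ?_
      simp only [List.append_assoc, List.mem_append, List.mem_cons, List.not_mem_nil,
        or_false] at hy
      rcases hy with hy | rfl | hy
      · exact hw.2 y (by simp [hy])
      · exact hk y (by simp)
      · exact hw.2 y (by simp [hy])
    have h2 := ih (fun y hy => hk y (by simp [hy])) hs (u ++ [x']) hl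
      (by rw [← numNodes_congr hs', hN])
    rw [h1]
    simpa using h2

/-- An invariant of diagrams with `N` crossings that only depends on shadows is invariant under
the shadows of regular isotopies. -/
lemma eq_of_shadowMove (hE : IsDubrovnikDifference a z E) {N : ℕ}
    (low : ∀ w, IsLink w → w ≠ [] → numNodes w < N → E w = 0) {l r : List Layer}
    (u v : List Layer) (h : ShadowMove l r) (hd : IsDiagram (u ++ l ++ v))
    (hN : numNodes (u ++ l ++ v) = N) :
    E ((u ++ l ++ v).map Layer.lift) = E ((u ++ r ++ v).map Layer.lift) ∧
      numNodes (u ++ r ++ v) = N := by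
  -- Choose crossings over `l` for which an actual regular move applies, perform it, and return to
  -- the default crossings; both changes of crossings are free by `eq_of_shadow`.
  have key : ∀ l' r', LocallyEq E l' r' → l'.map Layer.shadow = l.map Layer.shadow →
      r'.map Layer.shadow = r.map Layer.shadow → numNodes r = numNodes l →
      (∀ x ∈ l', x.kind ≠ .vertex) →
      E ((u ++ l ++ v).map Layer.lift) = E ((u ++ r ++ v).map Layer.lift) ∧
        numNodes (u ++ r ++ v) = N := by
    intro l' r' heq hl hr hn hk
    have hn' : numNodes (u ++ r ++ v) = N := by
      rw [← hN]
      simp [numNodes_append, hn]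
    refine ⟨?_, hn'⟩
    have hL := isLink_lift hd
    have hk' : ∀ x ∈ u.map Layer.lift ++ l' ++ v.map Layer.lift, x.kind ≠ .vertex := by
      intro x hx
      simp only [List.mem_append, List.mem_map] at hx
      rcases hx with (⟨y, -, rfl⟩ | hx) | ⟨y, -, rfl⟩
      · exact y.kind.lift_ne
      · exact hk x hx
      · exact y.kind.lift_ne
    have hsl : ((u ++ l ++ v).map Layer.lift).map Layer.shadow =
        (u.map Layer.lift ++ l' ++ v.map Layer.lift).map Layer.shadow := by
      simp only [List.map_append, map_shadow_lift, hl]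
    have hsr : (u.map Layer.lift ++ r' ++ v.map Layer.lift).map Layer.shadow =
        ((u ++ r ++ v).map Layer.lift).map Layer.shadow := by
      simp only [List.map_append, map_shadow_lift, hr]
    have hM := heq _ _ (isLink_of_shadow hL hsl hk')
    rw [hE.eq_of_shadow low hL ?_ hk' hsl, hM.2]
    · refine hE.eq_of_shadow low hM.1 ?_ ?_ hsr
      · rw [numNodes_congr hsr, ← hn']
        exact numNodes_congr (map_shadow_lift _)
      · intro x hx
        obtain ⟨y, -, rfl⟩ := List.mem_map.1 hx
        exact y.kind.lift_ne
    · rw [← hN]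
      exact numNodes_congr (map_shadow_lift _)
  cases h
  case lower k k' i j hij =>
    refine key [⟨k.lift, i⟩, ⟨k'.lift, j + k.lift.outs⟩] [⟨k'.lift, j + k.lift.ins⟩, ⟨k.lift, i⟩]
      (hE.move (.exchange _ _ i j hij)) ?_ ?_ ?_ ?_
    · cases k <;> cases k' <;> rfl
    · cases k <;> cases k' <;> rfl
    · cases k <;> cases k' <;> rfl
    · simp [Kind.lift_ne]
  case raise k k' i j hij =>
    refine key [⟨k'.lift, j + k.lift.ins⟩, ⟨k.lift, i⟩] [⟨k.lift, i⟩, ⟨k'.lift, j + k.lift.outs⟩]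
      (hE.move_symm (.exchange _ _ i j hij) (by simp)) ?_ ?_ ?_ ?_
    · cases k <;> cases k' <;> rfl
    · cases k <;> cases k' <;> rfl
    · cases k <;> cases k' <;> rfl
    · simp [Kind.lift_ne]
  case zigzagLeft i => exact key _ _ (hE.move (.zigzagLeft i)) rfl rfl rfl (by simp)
  case zigzagRight i => exact key _ _ (hE.move (.zigzagRight i)) rfl rfl rfl (by simp)
  case capRight i => exact key _ _ (hE.move (.overCap i)) rfl rfl rfl (by simp)
  case capLeft i => exact key _ _ (hE.move_symm (.overCap i) (by simp)) rfl rfl rfl (by simp)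
  case cupRight i => exact key _ _ (hE.move (.overCup i)) rfl rfl rfl (by simp)
  case cupLeft i => exact key _ _ (hE.move_symm (.overCup i) (by simp)) rfl rfl rfl (by simp)
  case braid i => exact key _ _ (hE.move (.reidemeisterThree i)) rfl rfl rfl (by simp)

/-- Crossings may be chosen freely: opposite ones open a bigon by the second Reidemeister move, and
a curl comes off with a unit factor, both leading to fewer crossings. Circles are removed until the
unknot is left, where `E` is `0`. -/
lemma eq_zero_of_null (hE : IsDubrovnikDifference a z E) (hz : z ∈ nonZeroDivisors R) {N : ℕ}
    (low : ∀ w, IsLink w → w ≠ [] → numNodes w < N → E w = 0) {w : List Layer} (h : Null w)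
    (hd : IsDiagram w) (hne : w ≠ []) (hN : numNodes w = N) : E (w.map Layer.lift) = 0 := by
  have count : ∀ w : List Layer, numNodes (w.map Layer.lift) = numNodes w :=
    fun w => numNodes_congr (map_shadow_lift w)
  induction h with
  | bigon u v i =>
    have hL := isLink_lift hd
    have hl : IsLink (u.map Layer.lift ++ [crossNW i, crossNE i] ++ v.map Layer.lift) := by
      refine isLink_of_shadow hL (by simp [Layer.shadow, Layer.lift, Kind.lift, Kind.shadow]) ?_
      have h2 := hL.2
      simp only [List.map_append, List.mem_append] at h2 ⊢
      rintro x ((hx | hx) | hx)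
      · exact h2 x (by simp [hx])
      · revert x; simp
      · exact h2 x (by simp [hx])
    rw [hE.eq_of_shadow low hL (by rw [count, hN]) hl.2
      (by simp [Layer.shadow, Layer.lift, Kind.lift, Kind.shadow])]
    have h2 := hE.move (.reidemeisterTwo i) _ _ hl
    rw [h2.2]
    obtain ⟨k, m, hu, hx, hv⟩ := hl.width
    simp only [IsTangle, Kind.ins, Kind.outs] at hx
    have := ne_nil_of_isTangle hu (by omega)
    refine low _ h2.1 (by simp_all) ?_
    simp only [numNodes_append, count] at hN ⊢
    simp [numNodes] at hN ⊢
    omega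
  | curlCup u v i =>
    have hL : IsLink (u.map Layer.lift ++ [cup i, crossNW i] ++ v.map Layer.lift) := by
      simpa [Layer.lift, Kind.lift] using isLink_lift hd
    simp only [List.map_append]
    refine (hE.curl_cup _ _ i hL).trans ?_
    rw [low, mul_zero]
    · exact isLink_replace hL (by intro a b; simp [IsTangle, Kind.ins, Kind.outs]) (by simp)
    · simp
    · simp only [numNodes_append, count] at hN ⊢
      simp [numNodes] at hN ⊢
      omega
  | curlCap u v i =>
    have hL : IsLink (u.map Layer.lift ++ [crossNW i, cap i] ++ v.map Layer.lift) := by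
      simpa [Layer.lift, Kind.lift] using isLink_lift hd
    simp only [List.map_append]
    refine (hE.curl_cap _ _ i hL).trans ?_
    rw [low, mul_zero]
    · exact isLink_replace hL (by intro a b; simp [IsTangle, Kind.ins, Kind.outs]; omega) (by simp)
    · simp
    · simp only [numNodes_append, count] at hN ⊢
      simp [numNodes] at hN ⊢
      omega
  | circle u v i _ ih =>
    have hL := isLink_lift hd
    simp only [List.map_append] at hL ⊢
    by_cases huv : u ++ v = []
    · obtain ⟨rfl, rfl⟩ := List.append_eq_nil_iff.1 huv
      obtain rfl : i = 0 := by simpa [IsDiagram, IsTangle, Kind.ins] using hd.1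
      exact hE.unknot
    · have hd' : IsDiagram (u ++ v) := by
        have := isTangle_replace (r := []) (l := [cup i, cap i]) (fun a b h => ?_) hd
        · rwa [List.append_nil] at this
        · simp only [IsTangle, Kind.ins, Kind.outs] at h ⊢
          omega
      refine hE.circle hz hL (by simpa using huv) ?_
      have := ih huv hd' huv (by
        simp only [numNodes_append] at hN ⊢
        simp [numNodes] at hN ⊢
        omega)
      simpa using this
  | @move l r u v h _ ih =>
    obtain ⟨h1, h2⟩ := hE.eq_of_shadowMove low u v h hd hN
    rw [h1]
    have hr : u ++ r ++ v ≠ [] := by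
      intro hr
      obtain ⟨hur, rfl⟩ := List.append_eq_nil_iff.1 hr
      obtain ⟨rfl, rfl⟩ := List.append_eq_nil_iff.1 hur
      cases h <;> simp [IsDiagram, IsTangle, Kind.ins, Kind.outs] at hd
    exact ih (isTangle_replace (fun _ _ => h.isTangle) hd) hr h2

/-- The empty diagram is excluded because no relation constrains `E []`. -/
theorem eq_zero (hE : IsDubrovnikDifference a z E) (hz : z ∈ nonZeroDivisors R)
    (w : List Layer) (hw : IsLink w) (hne : w ≠ []) : E w = 0 := by
  induction hN : numNodes w using Nat.strong_induction_on generalizing w with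
  | _ N ih =>
    have low : ∀ w, IsLink w → w ≠ [] → numNodes w < N → E w = 0 :=
      fun w hw hne hlt => ih _ hlt w hw hne rfl
    have hg := isPlanarGraph_shadow hw.1
    have hss : w.map Layer.shadow = ((w.map Layer.shadow).map Layer.lift).map Layer.shadow := by
      rw [map_shadow_lift, List.map_map]
      refine List.map_congr_left fun x _ => ?_
      obtain ⟨k, i⟩ := x
      cases k <;> rfl
    rw [hE.eq_of_shadow low hw hN (isLink_lift hg.1).2 hss]
    exact hE.eq_zero_of_null hz low (null_of_isPlanarGraph _ hg (by simpa using hne)) hg.1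
      (by simpa using hne) (by rw [numNodes_shadow, hN])

end IsDubrovnikDifference

/-! ### Expanding vertices in the orientation sum -/

section StateSum

variable {R : Type*} [CommRing R]

lemma transfer_sum {ι : Type*} (p q c : R) (w : List Layer) (L : List ι) (a : ι → R)
    (f : ι → List Bool → R) (s : List Bool) :
    transfer p q c w (fun b => (L.map fun t => a t * f t b).sum) s =
      (L.map fun t => a t * transfer p q c w (f t) s).sum := by
  induction L with
  | nil => simpa using transfer_mul p q c w 0 (fun _ => 0) s
  | cons t L ih => simp only [List.map_cons, List.sum_cons, transfer_add, transfer_mul, ih]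

/-- For parallel lower ends the crossing cancels the vertical smoothing. For antiparallel ones the
crossing cancels the part of the horizontal smoothing that exchanges the orientations; what remains
is `-A - B` times the alternating state, for either marker. -/
lemma sum_resolve (A B : R) (b : Bool) (x : Layer) (f : List Bool → R) (s : List Bool)
    (hs : x.pos + x.kind.ins ≤ s.length) :
    ((resolve A B b x).map fun t => t.1 * transfer A B (-A - B) t.2 f s).sum =
      layerTransfer A B (-A - B) x f s := by
  obtain ⟨k, i⟩ := x
  cases k <;> try simp [resolve, transfer]
  simp only [Kind.ins] at hs
  have hi : (s.take i).length = i := by simp; omega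
  have h := fun l => transfer_shift A B (-A - B) l f (s.take i) (s.drop i)
  have h1 := h [crossNE 0]
  have h2 := h [crossNW 0]
  have h3 := h [cap 0, cup 0]
  have h4 := h []
  have h5 := h [vertex 0]
  rw [hi, List.take_append_drop] at h1 h2 h3 h4 h5
  simp only [List.map_cons, List.map_nil, Nat.add_zero] at h1 h2 h3 h4 h5
  have h6 : layerTransfer A B (-A - B) (vertex i) f s = transfer A B (-A - B) [vertex i] f s := rfl
  obtain ⟨x, y, t, ht⟩ : ∃ x y t, s.drop i = x :: y :: t := by
    have : 2 ≤ (s.drop i).length := by simp; omega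
    revert this
    rcases s.drop i with _ | ⟨x, _ | ⟨y, b⟩⟩ <;> simp
  rw [h6]
  cases b <;> simp only [Bool.false_eq_true, if_false, if_true, List.map_cons, List.map_nil,
    List.sum_cons, List.sum_nil, h1, h2, h3, h4, h5, ht] <;>
    cases x <;> cases y <;> simp [transfer, layerTransfer_at_zero, kindTransfer] <;> ring

lemma sum_map_flatMap {α β : Type*} (L : List α) (g : α → List β) (h : β → R) :
    ((L.flatMap g).map h).sum = (L.map fun r => ((g r).map h).sum).sum := by
  induction L with
  | nil => rfl
  | cons x L ih => simp [ih]

lemma sum_states (A B : R) (m : ℕ → Bool) (w : List Layer) (f : List Bool → R) (s : List Bool)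
    {k : ℕ} (hs : IsTangle s.length w k) :
    ((states A B m w).map fun t => t.1 * transfer A B (-A - B) t.2 f s).sum =
      transfer A B (-A - B) w f s := by
  induction w generalizing m s with
  | nil => simp [states, transfer]
  | cons x w ih =>
    simp only [states, sum_map_flatMap, List.map_map, Function.comp_def, transfer_append, mul_assoc,
      List.sum_map_mul_left]
    simp only [← transfer_sum]
    rw [sum_resolve _ _ _ _ _ _ hs.1]
    refine layerTransfer_congr _ _ _ _ _ _ _ hs.1 fun t ht => ih _ t ?_
    rw [ht]
    exact hs.2

lemma resolve_isTangle (A B : R) (b : Bool) (x : Layer) {n : ℕ} (h : x.pos + x.kind.ins ≤ n)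
    (t : R × List Layer) (ht : t ∈ resolve A B b x) :
    IsTangle n t.2 (n - x.kind.ins + x.kind.outs) ∧ ∀ y ∈ t.2, y.kind ≠ .vertex := by
  obtain ⟨k, i⟩ := x
  simp only [Kind.ins, Kind.outs] at h ⊢
  cases k <;> simp only [resolve] at ht h ⊢
  case vertex =>
    cases b <;> simp at ht <;> rcases ht with rfl | rfl | rfl <;>
      simp [IsTangle, Kind.ins, Kind.outs] <;> omega
  all_goals
    simp at ht
    subst ht
    simp [IsTangle, Kind.ins, Kind.outs]
    try omega

lemma states_isTangle (A B : R) (m : ℕ → Bool) (w : List Layer) {n k : ℕ} (h : IsTangle n w k)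
    (t : R × List Layer) (ht : t ∈ states A B m w) :
    IsTangle n t.2 k ∧ ∀ y ∈ t.2, y.kind ≠ .vertex := by
  induction w generalizing m n t with
  | nil =>
    simp only [states, List.mem_singleton] at ht
    subst ht
    exact ⟨h, by simp⟩
  | cons x w ih =>
    simp only [states, List.mem_flatMap, List.mem_map] at ht
    obtain ⟨r, hr, t, ht, rfl⟩ := ht
    obtain ⟨h1, h2⟩ := resolve_isTangle A B _ x h.1 r hr
    obtain ⟨h3, h4⟩ := ih _ h.2 t ht
    refine ⟨isTangle_append.2 ⟨_, h1, h3⟩, fun y hy => ?_⟩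
    rcases List.mem_append.1 hy with hy | hy
    · exact h2 y hy
    · exact h4 y hy

end StateSum

/-! ### Counting alternating orientations -/

/-- The compatibility of colourings of the strands below and above a layer. -/
def IsCompatible (x : Layer) (g h : ℕ → Bool) : Prop :=
  (∀ j < x.pos, g j = h j) ∧ (∀ j ≥ x.pos, g (j + x.kind.ins) = h (j + x.kind.outs)) ∧
    match x.kind with
    | .cup => h x.pos = h (x.pos + 1)
    | .cap => g x.pos = g (x.pos + 1)
    | .vertex => ∀ s ≤ 1, ∀ t ≤ 1, g (x.pos + s) = h (x.pos + t)
    | _ => g x.pos = h (x.pos + 1) ∧ g (x.pos + 1) = h x.pos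

lemma respects_joined_iff (w : List Layer) (f : ℕ → ℕ → Bool) :
    (∀ a b, Joined w a b → f a.1 a.2 = f b.1 b.2) ↔
      ∀ k x, w[k]? = some x → IsCompatible x (f k) (f (k + 1)) := by
  constructor
  · intro h k x hx
    refine ⟨fun j hj => h _ _ (.left k j x hx hj), fun j hj => h _ _ (.right k j x hx hj), ?_⟩
    obtain ⟨kx, i⟩ := x
    cases kx
    · exact h _ _ (.cup k i hx)
    · exact h _ _ (.cap k i hx)
    · exact ⟨h _ _ (.crossUp k i (.inl hx)), h _ _ (.crossDown k i (.inl hx))⟩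
    · exact ⟨h _ _ (.crossUp k i (.inr hx)), h _ _ (.crossDown k i (.inr hx))⟩
    · exact fun s hs t ht => h _ _ (.vertex k i s t hx hs ht)
  · intro h a b hab
    cases hab with
    | left k j x hx hj => exact (h k x hx).1 j hj
    | right k j x hx hj => exact (h k x hx).2.1 j hj
    | cup k i hx => exact (h k _ hx).2.2
    | cap k i hx => exact (h k _ hx).2.2
    | crossUp k i hx => rcases hx with hx | hx <;> exact (h k _ hx).2.2.1
    | crossDown k i hx => rcases hx with hx | hx <;> exact (h k _ hx).2.2.2
    | vertex k i s t hx hs ht => exact (h k _ hx).2.2 s hs t ht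

/-- The colouring given by an orientation of strands: upward strands in even position and downward
strands in odd position have colour `true`. -/
def colouring (s : List Bool) (j : ℕ) : Bool := (s[j]?).elim false fun b => xor b j.bodd

lemma colouring_left (a b c : List Bool) {j : ℕ} (hj : j < a.length) :
    colouring (a ++ b) j = colouring (a ++ c) j := by
  simp [colouring, List.getElem?_append_left hj]

lemma colouring_right (a b : List Bool) (j : ℕ) :
    colouring (a ++ b) (a.length + j) = (b[j]?).elim false fun b => xor b (a.length + j).bodd := by
  rw [colouring, List.getElem?_append_right (by omega), Nat.add_sub_cancel_left]

lemma eq_colouring_append_iff {a b : List Bool} {h : ℕ → Bool} :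
    h = colouring (a ++ b) ↔ (∀ j < a.length, h j = colouring (a ++ b) j) ∧
      ∀ j, h (a.length + j) = (b[j]?).elim false fun b => xor b (a.length + j).bodd := by
  constructor
  · rintro rfl
    exact ⟨fun _ _ => rfl, colouring_right a b⟩
  · rintro ⟨h1, h2⟩
    funext j
    rcases lt_or_ge j a.length with hj | hj
    · exact h1 j hj
    · obtain ⟨d, rfl⟩ := Nat.exists_eq_add_of_le hj
      rw [h2, colouring_right]

lemma forall_nat_two {P : ℕ → Prop} : (∀ j, P j) ↔ P 0 ∧ P 1 ∧ ∀ j, P (j + 2) :=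
  ⟨fun h => ⟨h 0, h 1, fun _ => h _⟩, fun ⟨h0, h1, h2⟩ j => match j with
    | 0 => h0
    | 1 => h1
    | _ + 2 => h2 _⟩

lemma forall_ge_iff {P : ℕ → Prop} (i : ℕ) : (∀ j ≥ i, P j) ↔ ∀ j, P (i + j) :=
  ⟨fun h j => h _ (by omega), fun h j hj => by
    obtain ⟨d, rfl⟩ := Nat.exists_eq_add_of_le hj
    exact h d⟩

/-- The parity of a position is the checkerboard colour of the region to its left, and pieces shift
positions by even amounts. Hence opposite directions at neighbouring positions mean equal colours.
-/
lemma isCompatible_cup {a b : List Bool} {h : ℕ → Bool} :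
    IsCompatible (cup a.length) (colouring (a ++ b)) h ↔
      h = colouring (a ++ true :: false :: b) ∨ h = colouring (a ++ false :: true :: b) := by
  simp only [IsCompatible, Kind.ins, Kind.outs, forall_ge_iff, eq_colouring_append_iff,
    forall_nat_two (P := fun j => h (a.length + j) = _), add_zero, ← add_assoc, colouring_right]
  have e : ∀ c, (∀ j < a.length, h j = colouring (a ++ c) j) ↔
      ∀ j < a.length, colouring (a ++ b) j = h j := fun c =>
    forall₂_congr fun _ hj => by rw [colouring_left a c b hj, eq_comm]
  simp only [e]
  have e2 : (∀ j, (b[j]?).elim false (fun b => xor b (a.length + j).bodd) = h (a.length + j + 2)) ↔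
      ∀ j, h (a.length + j + 2) = (b[j]?).elim false (fun b => xor b (a.length + j + 2).bodd) :=
    forall_congr' fun j => by simp [eq_comm]
  simp only [e2]
  simp only [List.getElem?_cons_zero, List.getElem?_cons_succ, Option.elim_some, Nat.bodd_succ]
  cases h a.length <;> cases h (a.length + 1) <;> cases a.length.bodd <;> simp

lemma isCompatible_cap {a b : List Bool} {x y : Bool} {h : ℕ → Bool} :
    IsCompatible (cap a.length) (colouring (a ++ x :: y :: b)) h ↔
      x ≠ y ∧ h = colouring (a ++ b) := by
  simp only [IsCompatible, Kind.ins, Kind.outs, forall_ge_iff, eq_colouring_append_iff]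
  have e : (∀ j < a.length, h j = colouring (a ++ b) j) ↔
      ∀ j < a.length, colouring (a ++ x :: y :: b) j = h j :=
    forall₂_congr fun j hj => by rw [colouring_left a b (x :: y :: b) hj, eq_comm]
  have e2 : (∀ j, colouring (a ++ x :: y :: b) (a.length + j + 2) = h (a.length + j + 0)) ↔
      ∀ j, h (a.length + j) = (b[j]?).elim false (fun b => xor b (a.length + j).bodd) :=
    forall_congr' fun j => by
      rw [add_assoc, colouring_right]
      simp [← add_assoc, eq_comm]
  have e3 : colouring (a ++ x :: y :: b) a.length = colouring (a ++ x :: y :: b) (a.length + 1) ↔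
      x ≠ y := by
    have := colouring_right a (x :: y :: b) 0
    rw [add_zero] at this
    rw [this, colouring_right]
    cases x <;> cases y <;> cases hb : a.length.bodd <;> simp [hb]
  rw [e, e2, e3]
  tauto

/-- The four ends have equal colours exactly when their directions alternate between in and out,
which is when the transfer weight is `c`. -/
lemma isCompatible_vertex {a b : List Bool} {x y : Bool} {h : ℕ → Bool} :
    IsCompatible (vertex a.length) (colouring (a ++ x :: y :: b)) h ↔
      x ≠ y ∧ h = colouring (a ++ x :: y :: b) := by
  have e3 : colouring (a ++ x :: y :: b) a.length = colouring (a ++ x :: y :: b) (a.length + 1) ↔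
      x ≠ y := by
    have := colouring_right a (x :: y :: b) 0
    rw [add_zero] at this
    rw [this, colouring_right]
    cases x <;> cases y <;> cases hb : a.length.bodd <;> simp [hb]
  simp only [IsCompatible, Kind.ins, Kind.outs, forall_ge_iff]
  rw [← e3]
  constructor
  · rintro ⟨h1, h2, h3⟩
    have h00 := h3 0 (by omega) 0 (by omega)
    have h10 := h3 1 (by omega) 0 (by omega)
    have h11 := h3 1 (by omega) 1 (by omega)
    refine ⟨h00.trans h10.symm, ?_⟩
    funext j
    rcases lt_or_ge j a.length with hj | hj
    · exact (h1 j hj).symm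
    · obtain ⟨d, rfl⟩ := Nat.exists_eq_add_of_le hj
      match d with
      | 0 => exact h00.symm
      | 1 => exact h11.symm
      | d + 2 => exact (h2 d).symm
  · rintro ⟨h1, rfl⟩
    refine ⟨fun _ _ => rfl, fun _ => rfl, fun s hs t ht => ?_⟩
    interval_cases s <;> interval_cases t <;> simp [h1]

/-- Colourings of the points of a tangle that are constant on components, with a given colouring
at the bottom. -/
def colourings (w : List Layer) (g : ℕ → Bool) : Set (ℕ → ℕ → Bool) :=
  {f | f 0 = g ∧ (∀ k x, w[k]? = some x → IsCompatible x (f k) (f (k + 1))) ∧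
    ∀ k, w.length < k → f k = fun _ => false}

/-- Adds a row below a colouring. -/
def consRow (g : ℕ → Bool) (f : ℕ → ℕ → Bool) : ℕ → ℕ → Bool
  | 0 => g
  | k + 1 => f k

lemma consRow_injective (g : ℕ → Bool) : Function.Injective (consRow g) := fun _ _ h =>
  funext fun k => congrFun h (k + 1)

lemma colourings_cons (x : Layer) (w : List Layer) (g : ℕ → Bool) :
    colourings (x :: w) g = consRow g '' {f | IsCompatible x g (f 0) ∧ f ∈ colourings w (f 0)} := by
  ext f
  constructor
  · rintro ⟨rfl, h1, h2⟩
    refine ⟨fun k => f (k + 1), ⟨h1 0 x rfl, rfl, fun k y hy => h1 (k + 1) y hy,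
      fun k hk => h2 (k + 1) (by simpa using hk)⟩, ?_⟩
    funext k
    cases k <;> rfl
  · rintro ⟨f, ⟨h1, -, h2, h3⟩, rfl⟩
    refine ⟨rfl, fun k y hy => ?_, fun k hk => ?_⟩
    · cases k with
      | zero =>
        obtain rfl : x = y := by simpa using hy
        exact h1
      | succ k => exact h2 k y hy
    · cases k with
      | zero => simp at hk
      | succ k => exact h3 k (by simpa using hk)

lemma mem_colourings_self {w : List Layer} {f : ℕ → ℕ → Bool} {g : ℕ → Bool} :
    (f 0 = g ∧ f ∈ colourings w (f 0)) ↔ f ∈ colourings w g :=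
  ⟨fun ⟨h, h'⟩ => h ▸ h', fun h => ⟨h.1, h.1.symm ▸ h⟩⟩

/-- The layer recursion for colourings is that of the transfer operator, each vertex adding a factor
`c`. Finiteness is carried along because `Set.ncard` is additive only on finite disjoint sets. -/
lemma orientationSum_eq_ncard {R : Type*} [CommRing R] (p q c : R) (w : List Layer)
    (s : List Bool) (hw : IsTangle s.length w 0)
    (hk : ∀ x ∈ w, x.kind ≠ .crossNW ∧ x.kind ≠ .crossNE) :
    (colourings w (colouring s)).Finite ∧
      orientationSum p q c w s = c ^ numVertices w * (colourings w (colouring s)).ncard := by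
  induction w generalizing s with
  | nil =>
    have h : colourings [] (colouring s) = {consRow (colouring s) fun _ _ => false} := by
      ext f
      simp only [Set.mem_singleton_iff]
      constructor
      · rintro ⟨h1, -, h2⟩
        funext k
        cases k with
        | zero => exact h1
        | succ k => exact h2 _ (by simp)
      · rintro rfl
        refine ⟨rfl, by simp, fun k hk => ?_⟩
        cases k with
        | zero => simp at hk
        | succ k => rfl
    have hs : s = [] := List.length_eq_zero_iff.1 hw
    rw [h]
    simp [orientationSum, transfer, hs, numVertices]
  | cons x w ih =>
    have hk' : ∀ x ∈ w, x.kind ≠ .crossNW ∧ x.kind ≠ .crossNE := fun x hx => hk x (by simp [hx])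
    have hx := hk x (by simp)
    obtain ⟨k, i⟩ := x
    obtain ⟨hi, hw⟩ := hw
    simp only at hi hw
    rw [colourings_cons, Set.ncard_image_of_injective _ (consRow_injective _)]
    have hfin := fun S => (Set.finite_image_iff (s := S)
      (consRow_injective (colouring s)).injOn)
    rw [hfin]
    obtain ⟨a, b, rfl, rfl⟩ : ∃ a b, s = a ++ b ∧ a.length = i :=
      ⟨s.take i, s.drop i, (List.take_append_drop i s).symm, by simp; omega⟩
    have hop : ∀ f : List Bool → R, layerTransfer p q c ⟨k, a.length⟩ f (a ++ b) =
        kindTransfer p q c k (fun t => f (a ++ t)) b := fun f => by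
      rw [← layerTransfer_at_zero, ← layerTransfer_append, add_zero]
    have hsum : orientationSum p q c (⟨k, a.length⟩ :: w) (a ++ b) =
        kindTransfer p q c k (fun t => orientationSum p q c w (a ++ t)) b := hop _
    rw [hsum]
    cases k <;> simp at hx
    case cup =>
      have key : {f | IsCompatible (cup a.length) (colouring (a ++ b)) (f 0) ∧
          f ∈ colourings w (f 0)} = colourings w (colouring (a ++ true :: false :: b)) ∪
            colourings w (colouring (a ++ false :: true :: b)) := by
        ext f
        simp only [isCompatible_cup, Set.mem_ofPred_eq, Set.mem_union, or_and_right,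
          mem_colourings_self]
      obtain ⟨f1, e1⟩ := ih (a ++ true :: false :: b) (by
        simp [Kind.ins, Kind.outs] at hw ⊢; convert hw using 1; omega) hk'
      obtain ⟨f2, e2⟩ := ih (a ++ false :: true :: b) (by
        simp [Kind.ins, Kind.outs] at hw ⊢; convert hw using 1; omega) hk'
      have hd : Disjoint (colourings w (colouring (a ++ true :: false :: b)))
          (colourings w (colouring (a ++ false :: true :: b))) := by
        rw [Set.disjoint_left]
        rintro f ⟨h1, -⟩ ⟨h2, -⟩
        have := congrFun (h1.symm.trans h2) (a.length + 0)
        rw [colouring_right, colouring_right] at this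
        simp at this
      rw [key, Set.ncard_union_eq hd f1 f2]
      refine ⟨f1.union f2, ?_⟩
      simp only [kindTransfer, e1, e2]
      simp [numVertices]
      ring
    all_goals
      obtain ⟨x, y, b, rfl⟩ : ∃ x y t, b = x :: y :: t := by
        rcases b with _ | ⟨x, _ | ⟨y, b⟩⟩ <;> simp [Kind.ins] at hi ⊢
    case cap =>
      obtain ⟨f1, e1⟩ := ih (a ++ b) (by
        simp [Kind.ins, Kind.outs] at hw ⊢; convert hw using 1; omega) hk'
      have key : {f | IsCompatible (cap a.length) (colouring (a ++ x :: y :: b)) (f 0) ∧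
          f ∈ colourings w (f 0)} = if x = y then ∅ else colourings w (colouring (a ++ b)) := by
        ext f
        simp only [isCompatible_cap, Set.mem_ofPred_eq]
        split_ifs with hxy
        · simp [hxy]
        · simp only [ne_eq, hxy, not_false_eq_true, true_and, mem_colourings_self]
      rw [key]
      simp only [kindTransfer, e1]
      split_ifs
      · simp
      · exact ⟨f1, by simp [numVertices]⟩
    case vertex =>
      obtain ⟨f1, e1⟩ := ih (a ++ x :: y :: b) (by
        simp [Kind.ins, Kind.outs] at hw ⊢; convert hw using 1; omega) hk'
      have key : {f | IsCompatible (vertex a.length) (colouring (a ++ x :: y :: b)) (f 0) ∧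
          f ∈ colourings w (f 0)} =
            if x = y then ∅ else colourings w (colouring (a ++ x :: y :: b)) := by
        ext f
        simp only [isCompatible_vertex, Set.mem_ofPred_eq]
        split_ifs with hxy
        · simp [hxy]
        · simp only [ne_eq, hxy, not_false_eq_true, true_and, mem_colourings_self]
      rw [key]
      simp only [kindTransfer, e1]
      split_ifs
      · simp
      · refine ⟨f1, ?_⟩
        simp [numVertices]
        ring

/-- The level and position `b` are those of a point of the diagram. -/
def IsPoint (w : List Layer) (b : ℕ × ℕ) : Prop := b.1 ≤ w.length ∧ b.2 < width (w.take b.1)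

lemma isTangle_foldl {w : List Layer} {n m : ℕ} (h : IsTangle n w m) :
    w.foldl (fun n x => n - x.kind.ins + x.kind.outs) n = m := by
  induction w generalizing n with
  | nil => exact h
  | cons x w ih => exact ih h.2

lemma width_take_succ {w : List Layer} (hw : IsDiagram w) {k : ℕ} {x : Layer}
    (hx : w[k]? = some x) :
    k < w.length ∧ x.pos + x.kind.ins ≤ width (w.take k) ∧
      width (w.take (k + 1)) = width (w.take k) - x.kind.ins + x.kind.outs := by
  have hk : k < w.length := (List.getElem?_eq_some_iff.1 hx).1
  have ht : w.take (k + 1) = w.take k ++ [x] := by rw [List.take_add_one, hx]; rfl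
  refine ⟨hk, ?_, by rw [ht]; simp [width]⟩
  have hw' : IsTangle 0 (w.take (k + 1) ++ w.drop (k + 1)) 0 := by rwa [List.take_append_drop]
  obtain ⟨m, hm, -⟩ := isTangle_append.1 hw'
  rw [ht] at hm
  obtain ⟨n, hn, hx⟩ := isTangle_append.1 hm
  have := isTangle_foldl hn
  rw [width, this]
  exact hx.1

lemma Joined.isPoint_iff {w : List Layer} (hw : IsDiagram w) {a b : ℕ × ℕ} (h : Joined w a b) :
    IsPoint w a ↔ IsPoint w b := by
  simp only [IsPoint]
  cases h with
  | left k j x hx hj =>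
    obtain ⟨h1, h2, h3⟩ := width_take_succ hw hx
    simp only [h3]
    omega
  | right k j x hx hj =>
    obtain ⟨h1, h2, h3⟩ := width_take_succ hw hx
    simp only [h3]
    omega
  | cup k i hx =>
    obtain ⟨h1, h2, h3⟩ := width_take_succ hw hx
    simp only [h3, Kind.ins, Kind.outs] at h2 ⊢
    omega
  | cap k i hx =>
    obtain ⟨h1, h2, h3⟩ := width_take_succ hw hx
    simp only [Kind.ins] at h2 ⊢
    omega
  | crossUp k i hx =>
    rcases hx with hx | hx <;>
    · obtain ⟨h1, h2, h3⟩ := width_take_succ hw hx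
      simp only [h3, Kind.ins, Kind.outs] at h2 ⊢
      omega
  | crossDown k i hx =>
    rcases hx with hx | hx <;>
    · obtain ⟨h1, h2, h3⟩ := width_take_succ hw hx
      simp only [h3, Kind.ins, Kind.outs] at h2 ⊢
      omega
  | vertex k i s t hx hs ht =>
    obtain ⟨h1, h2, h3⟩ := width_take_succ hw hx
    simp only [h3, Kind.ins, Kind.outs] at h2 ⊢
    omega

/-- Compatibility also links the unused positions beyond the width of consecutive levels, so the
value `false` at the bottom propagates upwards. -/
lemma eq_false_of_not_isPoint {w : List Layer} (hw : IsDiagram w) {f : ℕ → ℕ → Bool}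
    (hf : f ∈ colourings w fun _ => false) (k j : ℕ) (h : ¬ IsPoint w (k, j)) : f k j = false := by
  rcases lt_or_ge w.length k with hk | hk
  · rw [hf.2.2 k hk]
  induction k generalizing j with
  | zero => rw [hf.1]
  | succ k ih =>
    have hx : w[k]? = some w[k] := List.getElem?_eq_getElem (by omega)
    obtain ⟨h1, h2, h3⟩ := width_take_succ hw hx
    simp only [IsPoint, hk, true_and, h3, not_lt] at h ih
    obtain ⟨d, rfl⟩ : ∃ d, j = d + w[k].kind.outs := ⟨j - w[k].kind.outs, by omega⟩
    rw [← (hf.2.1 k _ hx).2.1 d (by omega)]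
    exact ih _ (by simp only [show k ≤ w.length by omega, true_and, not_lt]; omega) (by omega)

/-- Colourings that are constant on components are functions on the set of components. -/
noncomputable def colouringsEquiv (w : List Layer) (hw : IsDiagram w) :
    colourings w (fun _ => false) ≃ ((Quot fun p q : Point w => Joined w p.1 q.1) → Bool) := by
  classical
  exact
  { toFun := fun f => Quot.lift (fun p => f.1 p.1.1 p.1.2) fun p q h =>
      (respects_joined_iff w f.1).2 f.2.2.1 _ _ h
    invFun := fun g => ⟨fun k j => if h : IsPoint w (k, j) then g (Quot.mk _ ⟨(k, j), h⟩) else false,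
      by
        refine ⟨?_, (respects_joined_iff w _).1 fun a b hab => ?_, fun k hk => ?_⟩
        · funext j
          exact dif_neg (by simp [IsPoint, width])
        · by_cases ha : IsPoint w a
          · have hb := (hab.isPoint_iff hw).1 ha
            rw [dif_pos ha, dif_pos hb]
            exact congrArg g (Quot.sound hab)
          · have hb := fun hb => ha ((hab.isPoint_iff hw).2 hb)
            rw [dif_neg ha, dif_neg hb]
        · funext j
          exact dif_neg fun h => absurd h.1 (by simpa using hk)⟩
    left_inv := fun f => by
      ext k j
      by_cases h : IsPoint w (k, j)
      · simp [h]
      · simp [h, eq_false_of_not_isPoint hw f.2 k j h]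
    right_inv := fun g => by
      funext c
      obtain ⟨p, rfl⟩ := Quot.exists_rep c
      exact dif_pos p.2 }

lemma finite_point (w : List Layer) : Finite (Point w) := by
  refine Finite.of_injective (β := Σ k : Fin (w.length + 1), Fin (width (w.take k)))
    (fun p => ⟨⟨p.1.1, Nat.lt_succ_of_le p.2.1⟩, ⟨p.1.2, p.2.2⟩⟩) ?_
  rintro ⟨⟨k, j⟩, h⟩ ⟨⟨k', j'⟩, h'⟩ heq
  simp only [Sigma.mk.injEq, Fin.mk.injEq] at heq
  obtain ⟨rfl, heq⟩ := heq
  exact Subtype.ext (by simpa using heq)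

lemma ncard_colourings (w : List Layer) (hw : IsDiagram w) :
    (colourings w fun _ => false).ncard = 2 ^ numComponents w := by
  have := finite_point w
  rw [← Nat.card_coe_set_eq, Nat.card_congr (colouringsEquiv w hw), Nat.card_fun, numComponents]
  simp

/-! ### Evaluation of the state sum -/

lemma halfOrientationSum_eq {R : Type*} [CommRing R] (p q c : R) (w : List Layer)
    (hw : IsPlanarGraph w) (hne : w ≠ []) :
    halfOrientationSum p q c w = 2 ^ (numComponents w - 1) * c ^ numVertices w := by
  obtain ⟨w, rfl, hw'⟩ := exists_eq_cup_cons hw.1 hne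
  have hk : ∀ x ∈ w, x.kind ≠ .crossNW ∧ x.kind ≠ .crossNE := fun x hx => hw.2 x (by simp [hx])
  have h1 := (orientationSum_eq_ncard p q c w [true, false] hw' hk).2
  -- With unit weights over `ℤ` the sum is the bare count. Reversal symmetry makes the full count
  -- twice the half count, and the halving takes place in `ℕ`, since `2` may be a zero divisor in
  -- `R`.
  have h2 := (orientationSum_eq_ncard (1 : ℤ) 1 1 w [true, false] hw' hk).2
  have h3 := (orientationSum_eq_ncard (1 : ℤ) 1 1 (cup 0 :: w) [] hw.1 hw.2).2
  have h4 := orientationSum_not (1 : ℤ) 1 1 w [true, false]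
  have h5 : orientationSum (1 : ℤ) 1 1 (cup 0 :: w) [] =
      orientationSum (1 : ℤ) 1 1 w [true, false] + orientationSum (1 : ℤ) 1 1 w [false, true] := by
    simp [orientationSum, transfer, layerTransfer, kindTransfer]
  have h6 : colouring [] = fun _ => false := by funext j; simp [colouring]
  rw [h6, ncard_colourings _ hw.1, h5, h2] at h3
  simp only [List.map_cons, List.map_nil, Bool.not_true, Bool.not_false] at h4
  rw [h4, h2] at h3
  simp only [one_pow, one_mul] at h3
  have hv : numVertices (cup 0 :: w) = numVertices w := by simp [numVertices]
  have hn : (colourings w (colouring [true, false])).ncard = 2 ^ (numComponents (cup 0 :: w) - 1) := by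
    have h7 : (colourings w (colouring [true, false])).ncard +
        (colourings w (colouring [true, false])).ncard = 2 ^ numComponents (cup 0 :: w) := by
      exact_mod_cast h3
    rcases Nat.eq_zero_or_pos (numComponents (cup 0 :: w)) with h0 | h0
    · rw [h0, pow_zero] at h7
      omega
    · obtain ⟨c, hc⟩ := Nat.exists_eq_succ_of_ne_zero h0.ne'
      rw [hc, Nat.pow_succ] at h7
      rw [hc, Nat.succ_sub_one]
      omega
  rw [halfOrientationSum, List.tail_cons, h1, hn, hv]
  push_cast
  ring

/-- The first layer is a minimum and survives in every state, so each state is a nonempty link and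
the expansion takes place above the fixed orientation. -/
lemma kauffmanVogel_eq {R : Type*} [CommRing R] {A B : R} {D : List Layer → R} (w : List Layer)
    (hw : IsPlanarGraph w) (hne : w ≠ []) (m : ℕ → Bool)
    (hD : ∀ l, IsLink l → l ≠ [] → D l = halfOrientationSum A B (-A - B) l) :
    kauffmanVogel D A B m w = halfOrientationSum A B (-A - B) w := by
  obtain ⟨w, rfl, hw'⟩ := exists_eq_cup_cons hw.1 hne
  have h1 := sum_states A B (fun k => m (k + 1)) w (fun t => if t = [] then 1 else 0)
    [true, false] hw'
  rw [halfOrientationSum, List.tail_cons, orientationSum, ← h1]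
  simp only [kauffmanVogel, states, resolve, List.flatMap_cons, List.flatMap_nil, List.append_nil,
    List.map_map, Function.comp_def, one_mul]
  congr 1
  refine List.map_congr_left fun t ht => ?_
  obtain ⟨h2, h3⟩ := states_isTangle A B _ w hw' t ht
  have hl : IsLink (cup 0 :: t.2) := ⟨⟨le_refl 0, h2⟩, by simpa using h3⟩
  exact congrArg (t.1 * ·) (hD _ hl (by simp))

end KauffmanVogel

theorem theorem4 {R : Type*} [CommRing R] (A : Rˣ)
    (hA : (A : R) - ((A⁻¹ : Rˣ) : R) ∈ nonZeroDivisors R) :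
    (∃ D : List KauffmanVogel.Layer → R,
      KauffmanVogel.IsDubrovnik A ((A : R) - ((A⁻¹ : Rˣ) : R)) D) ∧
    ∀ D : List KauffmanVogel.Layer → R,
      KauffmanVogel.IsDubrovnik A ((A : R) - ((A⁻¹ : Rˣ) : R)) D →
      ∀ G : List KauffmanVogel.Layer, KauffmanVogel.IsPlanarGraph G → G ≠ [] →
      ∀ markers : ℕ → Bool,
        KauffmanVogel.kauffmanVogel D (A : R) ((A⁻¹ : Rˣ) : R) markers G =
          2 ^ (KauffmanVogel.numComponents G - 1) *
            (-(A : R) - ((A⁻¹ : Rˣ) : R)) ^ KauffmanVogel.numVertices G := by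
  have h0 := KauffmanVogel.isDubrovnik_halfOrientationSum A (-(A : R) - ((A⁻¹ : Rˣ) : R))
  refine ⟨⟨_, h0⟩, fun D hD G hG hne markers => ?_⟩
  rw [KauffmanVogel.kauffmanVogel_eq G hG hne markers fun l hl hl' =>
    sub_eq_zero.1 ((hD.sub h0).eq_zero hA l hl hl')]
  exact KauffmanVogel.halfOrientationSum_eq _ _ _ G hG hne
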